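/- Let $P\in\mathbb C[z]$ be a polynomial of degree $d\ge 2$ such that both $P$ and $P'$ have only simple roots, and let $\alpha$ be a real number with $0<\alpha<d$. Let $\Lambda\subset\mathbb C_z\times\mathbb C_W$ be the affine curve $$\sum_{k=0}^{d}\frac{\alpha-k}{k!}\,P^{(k)}(z)\,W^{d-k}=0,$$ let $\widehat\Lambda$ be its closure in $\mathbb{CP}^1_z\times\mathbb{CP}^1_W$, let $\mathfrak n:\widetilde\Lambda\to\widehat\Lambda$ be the normalisation (so $\widetilde\Lambda$ is a compact Riemann surface), and let $\widetilde\Omega=\mathfrak n^*(W\,dz)$, a meromorphic $1$-form on $\widetilde\Lambda$. An irreducible affine plane curve is called an affine Boutroux curve if the integrals of the form $W\,dz$, pulled back to the normalisation of its closure in $\mathbb{CP}^1\times\mathbb{CP}^1$, over all closed loops avoiding the poles are purely imaginary. Then $\Lambda$ is an affine Boutroux curve. More exactly: (i) $\Lambda$ is an irreducible rational curve (its defining polynomial is irreducible), and $\widetilde\Lambda\cong\mathbb{CP}^1$. (ii) The only point of $\widehat\Lambda$ with $z=\infty$ is $(\infty,0)$. (iii) In the coordinates $(y,W)$ with $y=1/z$,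 the equation of the slopes $s$ (tangent lines $W=sy$) of $\widehat\Lambda$ at $(\infty,0)$ is, up to a nonzero constant factor, $(s+1)^{d-1}(\alpha(s+1)-d)=0$. It has exactly two distinct solutions: $s=\frac d\alpha-1$, which is simple, and $s=-1$, of multiplicity $d-1$. (iv) The only singular point of $\widehat\Lambda$ is $(\infty,0)$; $\mathfrak n$ is one-to-one over all other points of $\widehat\Lambda$, and the preimage of $(\infty,0)$ consists of $d$ points. (v) The $d$ local branches of $\widehat\Lambda$ at $(\infty,0)$, which correspond to these $d$ points, are all smooth; one of them has slope $\frac d\alpha-1$ and the other $d-1$ have slope $-1$. (vi) Over each of the $d$ points $(z_i,\infty)$, where $z_i$ runs over the roots of $P$, there is exactly one point $p_i\in\widetilde\Lambda$, and the residue of $\widetilde\Omega$ at $p_i$ is $\frac{1-\alpha}{\alpha}$. If $\alpha\ne1$, then $\widetilde\Omega$ has a simple pole at $p_i$; if $\alpha=1$, then $\widetilde\Omega$ has no pole at $p_i$. (vii) $\widetilde\Omega$ has a simple pole at each of the $d$ points over $(\infty,0)$; its residue is $1$ at each of the $d-1$ points that correspond to the branches of slope $-1$, and $\frac{\alpha-d}{\alpha}$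 at the point that corresponds to the branch of slope $\frac d\alpha-1$. The poles listed in (vi) and (vii) are all the poles of $\widetilde\Omega$. -/

import Mathlib

open Polynomial Filter Topology Manifold
open scoped ContDiff Polynomial.Bivariate

noncomputable section
/-! ### The Riemann sphere `OnePoint ℂ` as a complex manifold -/

namespace RiemannSphere

/-- The inversion `z ↦ 1 / z` of the Riemann sphere, exchanging `0` and `∞`. -/
def inv : OnePoint ℂ → OnePoint ℂ
  | none => ((0 : ℂ) : OnePoint ℂ)
  | some z => if z = 0 then OnePoint.infty else ((z⁻¹ : ℂ) : OnePoint ℂ)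

theorem inv_infty : inv OnePoint.infty = ((0 : ℂ) : OnePoint ℂ) := rfl

theorem inv_coe (z : ℂ) :
    inv (z : OnePoint ℂ) = if z = 0 then OnePoint.infty else ((z⁻¹ : ℂ) : OnePoint ℂ) := rfl

theorem inv_involutive : Function.Involutive inv := by
  intro x
  induction x using OnePoint.rec with
  | infty => simp [inv_infty, inv_coe]
  | coe z => by_cases h : z = 0 <;> simp [inv_infty, inv_coe, h]

theorem continuous_inv : Continuous inv := by
  rw [continuous_iff_continuousAt]
  intro x
  induction x using OnePoint.rec with
  | infty =>
    rw [OnePoint.continuousAt_infty', inv_infty, coclosedCompact_eq_cocompact,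
      ← Metric.cobounded_eq_cocompact]
    have h : Tendsto (fun z : ℂ => ((z⁻¹ : ℂ) : OnePoint ℂ)) (Bornology.cobounded ℂ)
        (𝓝 ((0 : ℂ) : OnePoint ℂ)) :=
      (OnePoint.continuous_coe.tendsto 0).comp tendsto_inv₀_cobounded
    refine h.congr' ?_
    filter_upwards [Bornology.eventually_ne_cobounded (0 : ℂ)] with z hz
    simp [inv_coe, hz]
  | coe z =>
    rw [OnePoint.continuousAt_coe]
    by_cases hz : z = 0
    · subst hz
      rw [← continuousWithinAt_compl_self]
      have h : Tendsto (fun z : ℂ => ((z⁻¹ : ℂ) : OnePoint ℂ)) (𝓝[≠] 0)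
          (𝓝 (OnePoint.infty : OnePoint ℂ)) := by
        have h1 : Tendsto ((↑) : ℂ → OnePoint ℂ) (Bornology.cobounded ℂ) (𝓝 OnePoint.infty) := by
          rw [OnePoint.nhds_infty_eq, coclosedCompact_eq_cocompact,
            ← Metric.cobounded_eq_cocompact]
          exact tendsto_map.mono_right le_sup_left
        exact h1.comp tendsto_inv₀_nhdsNE_zero
      have h2 : (inv ∘ ((↑) : ℂ → OnePoint ℂ)) 0 = OnePoint.infty := by simp [inv_coe]
      rw [ContinuousWithinAt, h2]
      refine h.congr' ?_
      filter_upwards [self_mem_nhdsWithin] with z hz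
      have hz' : z ≠ 0 := hz
      simp [inv_coe, hz']
    · have h : ContinuousAt (fun z : ℂ => ((z⁻¹ : ℂ) : OnePoint ℂ)) z :=
        OnePoint.continuous_coe.continuousAt.comp (continuousAt_inv₀ hz)
      refine h.congr ?_
      filter_upwards [isOpen_ne.mem_nhds hz] with w hw
      have hw' : w ≠ 0 := hw
      simp [inv_coe, hw']

/-- The inversion as a homeomorphism. -/
def invHomeomorph : OnePoint ℂ ≃ₜ OnePoint ℂ where
  toEquiv := inv_involutive.toPerm inv
  continuous_toFun := continuous_inv
  continuous_invFun := continuous_inv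

/-- The coordinate `z` on the complement of `∞`. -/
def finiteChart : OpenPartialHomeomorph (OnePoint ℂ) ℂ :=
  (OnePoint.isOpenEmbedding_coe.toOpenPartialHomeomorph ((↑) : ℂ → OnePoint ℂ)).symm

/-- The coordinate `1 / z` on the complement of `0`. -/
def inftyChart : OpenPartialHomeomorph (OnePoint ℂ) ℂ :=
  invHomeomorph.toOpenPartialHomeomorph.trans finiteChart

open Classical in
instance : ChartedSpace ℂ (OnePoint ℂ) where
  atlas := {finiteChart, inftyChart}
  chartAt x := if x = OnePoint.infty then inftyChart else finiteChart
  mem_chart_source x := by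
    induction x using OnePoint.rec with
    | infty => simpa [inftyChart, finiteChart] using ⟨(0 : ℂ), rfl⟩
    | coe z => simp [finiteChart]
  chart_mem_atlas x := by split_ifs <;> simp

/-- The value of the standard coordinate vanishing or finite at `x`: `z` itself at a finite point
`z`, and `1 / z = 0` at `∞`. -/
def coord : OnePoint ℂ → ℂ
  | none => 0
  | some z => z

end RiemannSphere
/-! ### Plane curves and their closures in the product of two Riemann spheres

A bivariate polynomial `F : ℂ[X][Y]` is evaluated at `(z, w)` by `F.evalEval z w`; the inner
variable is `z`, the outer one is `w`. -/

/-- The product of two Riemann spheres, with coordinates `(z, w)`. -/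
abbrev SphereSq : Type := OnePoint ℂ × OnePoint ℂ

/-- The closure in the product of two Riemann spheres of the affine curve `F = 0`. -/
def curveClosure (F : ℂ[X][Y]) : Set SphereSq :=
  closure {p | ∃ z w : ℂ, F.evalEval z w = 0 ∧ p = ((z : OnePoint ℂ), (w : OnePoint ℂ))}

open Classical in
/-- The polynomial equation of the closure in the standard affine chart at `p`: the coordinate `z`
is replaced by `1 / z` if `p.1 = ∞`, the coordinate `w` by `1 / w` if `p.2 = ∞`, and denominators
are cleared. -/
def localEquation (F : ℂ[X][Y]) (p : SphereSq) : ℂ[X][Y] :=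
  let G := if p.2 = OnePoint.infty then F.reverse else F
  if p.1 = OnePoint.infty then Bivariate.swap (Bivariate.swap G).reverse else G

/-- The singular points of the closure of the (reduced) curve `F = 0`: both partial derivatives of
the local equation vanish. -/
def singularPoints (F : ℂ[X][Y]) : Set SphereSq :=
  {p | p ∈ curveClosure F ∧
    fderiv ℂ (fun x : ℂ × ℂ => (localEquation F p).evalEval x.1 x.2)
      (RiemannSphere.coord p.1, RiemannSphere.coord p.2) = 0}

/-- The irreducible curve `F = 0` is rational: its function field is purely transcendental of
degree one over `ℂ`. -/
def IsRationalCurve (F : ℂ[X][Y]) : Prop :=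
  Irreducible F ∧
    Nonempty (FractionRing (ℂ[X][Y] ⧸ Ideal.span {F}) ≃ₐ[ℂ] RatFunc ℂ)

/-- `q` is the slope polynomial of the plane curve germ `G = 0` at the origin, where `G` vanishes
to order `m`: the terms of lowest degree `m` of `G (y, w)`, restricted to the line `w = s y`, are
`y ^ m * q (s)`. -/
def HasSlopePolynomial (G : ℂ[X][Y]) (m : ℕ) (q : ℂ[X]) : Prop :=
  q ≠ 0 ∧ ∃ R : ℂ[X][Y], ∀ y s : ℂ,
    G.evalEval y (s * y) = y ^ m * (q.eval s + y * R.evalEval y s)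

/-! ### Normalisation, and the form `w dz` on it -/

section Normalisation

variable {M : Type} [TopologicalSpace M] [ChartedSpace ℂ M]

/-- `ν : M → ℂP¹ × ℂP¹` is the normalisation of the closure of the curve `F = 0`: `M` is a compact
connected Riemann surface, and `ν` is holomorphic, maps `M` onto the closure, and is injective away
from finitely many points. -/
structure IsNormalisation (F : ℂ[X][Y]) (ν : M → SphereSq) : Prop where
  isManifold : IsManifold 𝓘(ℂ) ω M
  compact : CompactSpace M
  t2 : T2Space M
  connected : ConnectedSpace M
  holomorphic_fst : MDifferentiable 𝓘(ℂ) 𝓘(ℂ) (fun p => (ν p).1)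
  holomorphic_snd : MDifferentiable 𝓘(ℂ) 𝓘(ℂ) (fun p => (ν p).2)
  range_eq : Set.range ν = curveClosure F
  finite_nonInjective : {p | ∃ q, q ≠ p ∧ ν q = ν p}.Finite

/-- The coefficient `h` of the pullback `ν^*(w dz) = h(t) dt` in the preferred chart at `p`. It is
meaningful on a punctured neighbourhood of the point `t = chartAt ℂ p p`. -/
def formCoeff (ν : M → SphereSq) (p : M) (t : ℂ) : ℂ :=
  RiemannSphere.coord (ν ((chartAt ℂ p).symm t)).2 *
    deriv (fun s => RiemannSphere.coord (ν ((chartAt ℂ p).symm s)).1) t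

/-- The order at `p` of the meromorphic form `ν^*(w dz)`. -/
def formOrder (ν : M → SphereSq) (p : M) : WithTop ℤ :=
  meromorphicOrderAt (formCoeff ν p) (chartAt ℂ p p)

/-- The residue of `ν^*(w dz)` at `p` is `r`. -/
def HasFormResidue (ν : M → SphereSq) (p : M) (r : ℂ) : Prop :=
  ∀ᶠ ε in 𝓝[>] (0 : ℝ),
    (2 * Real.pi * Complex.I)⁻¹ * (∮ t in C(chartAt ℂ p p, ε), formCoeff ν p t) = r

/-- The value at `p` of `ν^*(w dz)`, where it has no pole, on the unit tangent vector of the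
preferred chart at `p`. -/
def formValue (ν : M → SphereSq) (p : M) : ℂ :=
  limUnder (𝓝[≠] (chartAt ℂ p p)) (formCoeff ν p)

/-- The integral of `ν^*(w dz)` over a `C¹` path parametrised by `[0, 1]`. -/
def formIntegral (ν : M → SphereSq) (γ : ℝ → M) : ℂ :=
  ∫ t in (0 : ℝ)..1, formValue ν (γ t) *
    (show ℂ from mfderivWithin 𝓘(ℝ, ℝ) 𝓘(ℝ, ℂ) γ (Set.Icc 0 1) t (1 : ℝ))

/-- The form `ν^*(w dz)` has purely imaginary periods: its integrals over all closed `C¹` loops that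
avoid its poles are purely imaginary. (Such loops generate the first homology group.) -/
def HasImaginaryPeriods (ν : M → SphereSq) : Prop :=
  ∀ γ : ℝ → M, ContMDiffOn 𝓘(ℝ, ℝ) 𝓘(ℝ, ℂ) 1 γ (Set.Icc 0 1) → γ 0 = γ 1 →
    (∀ t ∈ Set.Icc (0 : ℝ) 1, 0 ≤ formOrder ν (γ t)) → (formIntegral ν γ).re = 0

/-- The local branch at `(∞, 0)` parametrised by `ν` near `p` is smooth with slope `s`: as a germ
of sets it is the graph `w = f(y)` of a holomorphic function of the coordinate `y = 1 / z`, with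
`f(0) = 0` and `f'(0) = s`. -/
def IsSmoothBranchAtInfty (ν : M → SphereSq) (p : M) (s : ℂ) : Prop :=
  ∃ f : ℂ → ℂ, AnalyticAt ℂ f 0 ∧ f 0 = 0 ∧ deriv f 0 = s ∧
    map ν (𝓝 p) =
      map (fun y : ℂ => (RiemannSphere.inv (y : OnePoint ℂ), ((f y : ℂ) : OnePoint ℂ))) (𝓝 0)

end Normalisation

/-- The affine curve `F = 0` is an affine Boutroux curve: it is irreducible and the form `w dz` has
purely imaginary periods on the normalisation of its closure. -/
def IsAffineBoutroux (F : ℂ[X][Y]) : Prop :=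
  Irreducible F ∧
    ∃ (M : Type) (_ : TopologicalSpace M) (_ : ChartedSpace ℂ M) (ν : M → SphereSq),
      IsNormalisation F ν ∧ HasImaginaryPeriods ν

/-! ### The scaled symbol curve -/

/-- Both `P` and its derivative have only simple roots. -/
def StronglyGeneric (P : ℂ[X]) : Prop :=
  P.roots.Nodup ∧ (derivative P).roots.Nodup

/-- The polynomial `∑ k ≤ d, (α - k) / k! * P^(k)(z) * w ^ (d - k)` with `d = deg P`. -/
def scaledSymbol (P : ℂ[X]) (α : ℝ) : ℂ[X][Y] :=
  ∑ k ∈ Finset.range (P.natDegree + 1),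
    C (C (((α : ℂ) - k) / (k.factorial : ℂ)) * derivative^[k] P) * X ^ (P.natDegree - k)

end

/-! ### The substitution `u = z + 1 / w` -/

section Algebra

variable {A : Type*} [CommRing A] [Algebra ℂ A]

/-! By Taylor's formula the defining polynomial equals `W^(d-1) (α W P(u) - P'(u))` with `u = z +
1/W`, wherever `W ≠ 0` (`aevalAeval_scaledSymbol`). Its constant term in `W` is a nonzero constant
because `α < d`, so `W` never vanishes on the affine curve and `u` is a coordinate there: `W = P'(u)
/ (α P(u))`, `z = u - α P(u) / P'(u)`.

The same computation in the coordinate ring embeds that ring into `ℂ(u)`, which gives irreducibility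
and rationality (`exists_injective_algHom_ratFunc`). On the Riemann sphere it gives `symbolParam`, a
holomorphic map onto the closure that is injective off the fibre of `(∞, 0)`; this fibre consists of
`u = ∞` and the roots of `P'`. Since `y = 1/z` is a local parameter at each of these points, the
branches are smooth, and their slopes are the values of `z W`: `-1` at a root of `P'` and `d/α - 1`
at `∞`.

In the parameter, `W dz` is the logarithmic differential of `P^((1-α)/α) P'`. Hence its poles are at
most simple, with residue `(1-α)/α` at roots of `P`, `1` at roots of `P'`, and `(α-d)/α` at `∞`. The
exponents are real, so `Re (W dz)` is the differential of the single-valued function `((1-α)/α)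
log|P| + log|P'|`, and all periods are imaginary (`hasImaginaryPeriods`). -/

theorem aeval_add_eq_sum_iterate_derivative (P : ℂ[X]) (z t : A) {n : ℕ} (hn : P.natDegree < n) :
    aeval (z + t) P = ∑ k ∈ Finset.range n,
      algebraMap ℂ A (1 / (k.factorial : ℂ)) * aeval z (derivative^[k] P) * t ^ k := by
  have h1 : aeval (z + t) P = (taylor z (P.map (algebraMap ℂ A))).eval t := by
    rw [taylor_eval, add_comm, aeval_def, eval_map]
  have h2 : (taylor z (P.map (algebraMap ℂ A))).natDegree < n := by
    rw [natDegree_taylor]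
    exact natDegree_map_le.trans_lt hn
  rw [h1, eval_eq_sum_range' h2]
  refine Finset.sum_congr rfl fun k _ => ?_
  congr 1
  rw [taylor_coeff]
  have h3 : aeval z (derivative^[k] P)
      = (k.factorial : A) * (hasseDeriv k (P.map (algebraMap ℂ A))).eval z := by
    rw [aeval_def, ← eval_map, ← iterate_derivative_map, ← factorial_smul_hasseDeriv]
    simp
  have h4 : algebraMap ℂ A (1 / (k.factorial : ℂ)) * (k.factorial : A) = 1 := by
    rw [← map_natCast (algebraMap ℂ A), ← map_mul, one_div,
      inv_mul_cancel₀ (Nat.cast_ne_zero.2 k.factorial_ne_zero), map_one]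
  rw [h3, ← mul_assoc, h4, one_mul]

/-- Split `α - k`: the `α` part is Taylor's formula for `P`, and `k/k! = 1/(k-1)!` turns the rest
into `t` times Taylor's formula for `P'`. -/
theorem sum_sub_mul_iterate_derivative (P : ℂ[X]) (α : ℝ) (z t : A) :
    ∑ k ∈ Finset.range (P.natDegree + 1),
      algebraMap ℂ A (((α : ℂ) - k) / (k.factorial : ℂ)) * aeval z (derivative^[k] P) * t ^ k
      = algebraMap ℂ A α * aeval (z + t) P - t * aeval (z + t) (derivative P) := by
  have h2 : t * aeval (z + t) (derivative P) = ∑ k ∈ Finset.range (P.natDegree + 1),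
      algebraMap ℂ A ((k : ℂ) / (k.factorial : ℂ)) * aeval z (derivative^[k] P) * t ^ k := by
    -- Expanding `P'` with only `natDegree P` terms needs `deg P' < deg P`, which fails for
    -- constants.
    rcases Nat.eq_zero_or_pos P.natDegree with h0 | h0
    · rw [h0, derivative_of_natDegree_zero h0]
      simp
    rw [aeval_add_eq_sum_iterate_derivative (derivative P) z t (natDegree_derivative_lt h0.ne'),
      Finset.sum_range_succ', Finset.mul_sum]
    simp only [Nat.cast_zero, zero_div, map_zero, zero_mul, add_zero]
    refine Finset.sum_congr rfl fun k _ => ?_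
    have hk : ((k + 1 : ℕ) : ℂ) / ((k + 1).factorial : ℂ) = 1 / (k.factorial : ℂ) := by
      rw [Nat.factorial_succ]
      have := (Nat.cast_ne_zero (R := ℂ)).2 k.factorial_ne_zero
      have := (Nat.cast_ne_zero (R := ℂ)).2 k.succ_ne_zero
      push_cast at *
      field_simp
    rw [hk, Function.iterate_succ_apply]
    ring
  rw [h2, aeval_add_eq_sum_iterate_derivative P z t (Nat.lt_succ_self _), Finset.mul_sum,
    ← Finset.sum_sub_distrib]
  refine Finset.sum_congr rfl fun k _ => ?_
  have : ((α : ℂ) - k) / (k.factorial : ℂ) = α * (1 / (k.factorial : ℂ)) - k / k.factorial := by ring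
  rw [this, map_sub, map_mul]
  ring

theorem aevalAeval_scaledSymbol_eq_sum (P : ℂ[X]) (α : ℝ) (z w : A) :
    aevalAeval (R := ℂ) z w (scaledSymbol P α) = ∑ k ∈ Finset.range (P.natDegree + 1),
      algebraMap ℂ A (((α : ℂ) - k) / (k.factorial : ℂ)) * aeval z (derivative^[k] P)
        * w ^ (P.natDegree - k) := by
  rw [scaledSymbol, map_sum]
  refine Finset.sum_congr rfl fun k _ => ?_
  rw [map_mul, map_pow, aevalAeval_C, aevalAeval_Y, map_mul, aeval_C]

/-- The inverse `v` of `w` is an element of an arbitrary algebra because the identity serves over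
`ℂ`, in `ℂ(u)` and in the coordinate ring. -/
theorem aevalAeval_scaledSymbol {P : ℂ[X]} (hP : P.natDegree ≠ 0) (α : ℝ) {z w v : A}
    (h : w * v = 1) :
    aevalAeval (R := ℂ) z w (scaledSymbol P α) = w ^ (P.natDegree - 1) *
      (algebraMap ℂ A α * w * aeval (z + v) P - aeval (z + v) (derivative P)) := by
  have h1 : aevalAeval (R := ℂ) z w (scaledSymbol P α) = w ^ P.natDegree *
      (algebraMap ℂ A α * aeval (z + v) P - v * aeval (z + v) (derivative P)) := by
    rw [← sum_sub_mul_iterate_derivative, aevalAeval_scaledSymbol_eq_sum, Finset.mul_sum]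
    refine Finset.sum_congr rfl fun k hk => ?_
    have hk' : k ≤ P.natDegree := Nat.lt_succ_iff.1 (Finset.mem_range.1 hk)
    have : w ^ P.natDegree * v ^ k = w ^ (P.natDegree - k) := by
      conv_lhs => rw [← Nat.sub_add_cancel hk', pow_add, mul_assoc, ← mul_pow, h, one_pow, mul_one]
    rw [← this]
    ring
  have h2 : w ^ P.natDegree = w ^ (P.natDegree - 1) * w := by
    rw [← pow_succ, Nat.sub_add_cancel (Nat.one_le_iff_ne_zero.2 hP)]
  rw [h1, h2]
  linear_combination -(w ^ (P.natDegree - 1)) * aeval (z + v) (derivative P) * h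

end Algebra

theorem evalEval_scaledSymbol {P : ℂ[X]} (hP : P.natDegree ≠ 0) (α : ℝ) (z : ℂ) {w : ℂ}
    (hw : w ≠ 0) :
    (scaledSymbol P α).evalEval z w = w ^ (P.natDegree - 1) *
      (α * w * P.eval (z + w⁻¹) - (derivative P).eval (z + w⁻¹)) := by
  have := aevalAeval_scaledSymbol (A := ℂ) hP α (z := z) (mul_inv_cancel₀ hw)
  rw [coe_aevalAeval_eq_evalEval] at this
  simpa [coe_aeval_eq_eval] using this

/-! ### Leading and constant coefficients in `w`. -/

theorem coeff_scaledSymbol (P : ℂ[X]) (α : ℝ) {k : ℕ} (hk : k ≤ P.natDegree) :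
    (scaledSymbol P α).coeff (P.natDegree - k)
      = C (((α : ℂ) - k) / (k.factorial : ℂ)) * derivative^[k] P := by
  rw [scaledSymbol, finsetSum_coeff, Finset.sum_eq_single k]
  · rw [coeff_C_mul, coeff_X_pow, if_pos rfl, mul_one]
  · intro j hj hjk
    have := Nat.lt_succ_iff.1 (Finset.mem_range.1 hj)
    rw [coeff_C_mul, coeff_X_pow, if_neg (by omega), mul_zero]
  · intro h
    exact absurd (Finset.mem_range.2 (Nat.lt_succ_iff.2 hk)) h

theorem natDegree_scaledSymbol_le (P : ℂ[X]) (α : ℝ) :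
    (scaledSymbol P α).natDegree ≤ P.natDegree := by
  refine natDegree_sum_le_of_forall_le _ _ fun k _ => ?_
  exact (natDegree_C_mul_X_pow_le _ _).trans (Nat.sub_le _ _)

theorem natDegree_scaledSymbol {P : ℂ[X]} (hP : P ≠ 0) {α : ℝ} (hα : α ≠ 0) :
    (scaledSymbol P α).natDegree = P.natDegree := by
  refine natDegree_eq_of_le_of_coeff_ne_zero (natDegree_scaledSymbol_le P α) ?_
  have := coeff_scaledSymbol P α (Nat.zero_le _)
  rw [Nat.sub_zero] at this
  rw [this]
  simpa using ⟨hα, hP⟩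

theorem leadingCoeff_scaledSymbol {P : ℂ[X]} (hP : P ≠ 0) {α : ℝ} (hα : α ≠ 0) :
    (scaledSymbol P α).leadingCoeff = C (α : ℂ) * P := by
  have := coeff_scaledSymbol P α (Nat.zero_le _)
  rw [Nat.sub_zero] at this
  rw [leadingCoeff, natDegree_scaledSymbol hP hα, this]
  simp

/-- The constant term in `w` is a nonzero constant. -/
theorem exists_coeff_zero_scaledSymbol {P : ℂ[X]} (hP : P ≠ 0) {α : ℝ} (hα : α < P.natDegree) :
    ∃ c : ℂ, c ≠ 0 ∧ (scaledSymbol P α).coeff 0 = C c := by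
  have := coeff_scaledSymbol P α le_rfl
  rw [Nat.sub_self, ← factorial_smul_hasseDeriv, LinearMap.smul_apply,
    hasseDeriv_natDegree_eq_C] at this
  -- The `d`-th derivative of `P` is `d!` times its leading coefficient, and `d!` cancels the
  -- denominator.
  refine ⟨((α : ℂ) - P.natDegree) * P.leadingCoeff, mul_ne_zero ?_ (leadingCoeff_ne_zero.2 hP), ?_⟩
  · rw [sub_ne_zero]
    exact_mod_cast hα.ne
  · rw [this, nsmul_eq_mul, ← C_eq_natCast, ← C_mul, ← C_mul]
    congr 1
    have := (Nat.cast_ne_zero (R := ℂ)).2 P.natDegree.factorial_ne_zero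
    field_simp

/-- This is what makes `u = z + 1/w` defined on the whole affine curve. -/
theorem evalEval_scaledSymbol_zero_ne {P : ℂ[X]} (hP : P ≠ 0) {α : ℝ} (hα : α < P.natDegree)
    (z : ℂ) : (scaledSymbol P α).evalEval z 0 ≠ 0 := by
  obtain ⟨c, hc, h⟩ := exists_coeff_zero_scaledSymbol hP hα
  rw [evalEval, C_0, ← coeff_zero_eq_eval_zero, h, eval_C]
  exact hc

/-! ### Irreducibility and rationality -/

/-- The elements that become polynomials in `u` after multiplication by a power of `D(u)` form a
subalgebra, so it is enough to test the generators `x` and `y`. -/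
theorem exists_pow_mul_aeval_eq {A : Type*} [CommRing A] [Algebra ℂ A] {D : ℂ[X]} {u x y : A}
    (hx : ∃ g : ℂ[X], aeval u D * x = aeval u g) (hy : ∃ g : ℂ[X], aeval u D * y = aeval u g)
    (G : ℂ[X][Y]) :
    ∃ (n : ℕ) (g : ℂ[X]), aeval u D ^ n * aevalAeval (R := ℂ) x y G = aeval u g := by
  let S : A → Prop := fun a => ∃ (n : ℕ) (g : ℂ[X]), aeval u D ^ n * a = aeval u g
  have hadd : ∀ a b, S a → S b → S (a + b) := by
    rintro a b ⟨n, g, hg⟩ ⟨m, f, hf⟩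
    refine ⟨n + m, D ^ m * g + D ^ n * f, ?_⟩
    simp only [map_add, map_mul, map_pow, ← hg, ← hf]
    ring
  have hmul : ∀ a b, S a → S b → S (a * b) := by
    rintro a b ⟨n, g, hg⟩ ⟨m, f, hf⟩
    refine ⟨n + m, g * f, ?_⟩
    rw [map_mul, ← hg, ← hf]
    ring
  have hxS : S x := by
    obtain ⟨g, hg⟩ := hx
    exact ⟨1, g, by rw [pow_one, hg]⟩
  have hyS : S y := by
    obtain ⟨g, hg⟩ := hy
    exact ⟨1, g, by rw [pow_one, hg]⟩
  have hC : ∀ p : ℂ[X], S (aeval x p) := by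
    intro p
    induction p using Polynomial.induction_on with
    | C c => exact ⟨0, C c, by simp⟩
    | add p q hp hq => rw [map_add]; exact hadd _ _ hp hq
    | monomial n c h =>
      rw [pow_succ, ← mul_assoc, map_mul, aeval_X]
      exact hmul _ _ h hxS
  change S _
  induction G using Polynomial.induction_on with
  | C p => rw [aevalAeval_C]; exact hC p
  | add p q hp hq => rw [map_add]; exact hadd _ _ hp hq
  | monomial n c h =>
    rw [pow_succ, ← mul_assoc, map_mul, aevalAeval_Y]
    exact hmul _ _ h hyS

theorem isCoprime_derivative_of_nodup_roots {P : ℂ[X]} (hP : P ≠ 0) (h : P.roots.Nodup) :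
    IsCoprime P (derivative P) :=
  (nodup_roots_iff_of_splits hP (IsAlgClosed.splits P)).1 h

/-- On a quotient of `ℂ[z, w]` in which the scaled symbol vanishes, `w` is invertible, and
all elements are fractions in `u = z + 1 / w` with invertible denominators. -/
theorem exists_unit_fraction_of_scaledSymbol_eq_zero {A : Type*} [CommRing A] [Algebra ℂ A]
    {P : ℂ[X]} {α : ℝ} (hd : P.natDegree ≠ 0)
    (hP : IsCoprime P (derivative P)) (hα₀ : α ≠ 0) (hα₁ : α < P.natDegree)
    (π : ℂ[X][Y] →ₐ[ℂ] A) (hπF : π (scaledSymbol P α) = 0) :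
    ∃ v u : A, π X * v = 1 ∧ u = π (C X) + v ∧
      ∀ G, ∃ (n : ℕ) (g : ℂ[X]), aeval u (P * derivative P) ^ n * π G = aeval u g ∧
        (g = 0 → π G = 0) := by
  have hP0 : P ≠ 0 := by rintro rfl; simp at hd
  have hα : (α : ℂ) ≠ 0 := by exact_mod_cast hα₀
  set F := scaledSymbol P α with hF
  let x := π (C X)
  let y := π X
  have hπ : ∀ G, π G = aevalAeval (R := ℂ) x y G := by
    intro G
    have : π = aevalAeval (R := ℂ) x y := by
      ext
      · simp [x]
      · simp [y]
    rw [this]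
  obtain ⟨c, hc, hFc⟩ := exists_coeff_zero_scaledSymbol hP0 hα₁
  obtain ⟨v', hv'⟩ : ∃ v', y * v' = 1 := by
    -- From `F = X * divX F + c` and `π F = 0`, the product of `y` and `π (divX F)` is `-c`.
    refine ⟨- (π (C (C c⁻¹)) * π F.divX), ?_⟩
    have h1 := congrArg π (X_mul_divX_add F)
    rw [hFc, map_add, map_mul, hπF] at h1
    have h2 : π (C (C c⁻¹)) * π (C (C c)) = 1 := by
      rw [← map_mul, ← C_mul, ← C_mul, inv_mul_cancel₀ hc, C_1, C_1, map_one]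
    linear_combination h2 - π (C (C c⁻¹)) * h1
  let u := x + v'
  have hy_unit : IsUnit y := IsUnit.of_mul_eq_one _ hv'
  have hrel : algebraMap ℂ _ (α : ℂ) * y * aeval u P = aeval u (derivative P) := by
    have h1 := aevalAeval_scaledSymbol hd α (z := x) hv'
    rw [← hF, ← hπ, hπF] at h1
    exact sub_eq_zero.1 (((hy_unit.pow _).mul_right_eq_zero).1 h1.symm)
  obtain ⟨r, s, hrs⟩ := hP
  have hbez : aeval u r * aeval u P + aeval u s * aeval u (derivative P) = 1 := by
    rw [← map_mul, ← map_mul, ← map_add, hrs, map_one]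
  have hPu : IsUnit (aeval u P) := by
    -- Substituting `P'(u) = α y P(u)` into the Bézout identity exhibits an inverse of `P(u)`.
    refine IsUnit.of_mul_eq_one (aeval u r + aeval u s * (algebraMap ℂ _ (α : ℂ) * y)) ?_
    linear_combination hbez + aeval u s * hrel
  have haA : (algebraMap ℂ A (α : ℂ)⁻¹) * algebraMap ℂ _ (α : ℂ) = 1 := by
    rw [← map_mul, inv_mul_cancel₀ hα, map_one]
  have hP'u : IsUnit (aeval u (derivative P)) := by
    rw [← hrel]
    exact ((IsUnit.of_mul_eq_one_right _ haA).mul hy_unit).mul hPu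
  have hxD : ∃ g : ℂ[X], aeval u (P * derivative P) * x = aeval u g := by
    -- This numerator clears the denominator in `x = u - α P(u) / P'(u)`.
    refine ⟨P * derivative P * X - C (α : ℂ) * P ^ 2, ?_⟩
    simp only [map_sub, map_mul, map_pow, aeval_X, aeval_C]
    have : x = u - v' := by simp [u]
    rw [this]
    linear_combination aeval u P * v' * hrel - algebraMap ℂ _ (α : ℂ) * aeval u P ^ 2 * hv'
  have hyD : ∃ g : ℂ[X], aeval u (P * derivative P) * y = aeval u g := by
    -- Likewise for `y = P'(u) / (α P(u))`.
    refine ⟨C (α : ℂ)⁻¹ * derivative P ^ 2, ?_⟩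
    simp only [map_mul, map_pow, aeval_C]
    linear_combination
      algebraMap ℂ A (α : ℂ)⁻¹ * aeval u (derivative P) * hrel
      - aeval u P * aeval u (derivative P) * y * haA
  refine ⟨v', u, hv', rfl, fun G => ?_⟩
  obtain ⟨n, g, hg⟩ := exists_pow_mul_aeval_eq hxD hyD G
  rw [← hπ] at hg
  refine ⟨n, g, hg, fun hg0 => ?_⟩
  rw [hg0, map_zero, map_mul] at hg
  exact (((hPu.mul hP'u).pow n).mul_right_eq_zero).1 hg

/-- The coordinate ring of the curve embeds into `ℂ(u)`, and `u` lies in the image. -/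
theorem exists_injective_algHom_ratFunc {P : ℂ[X]} {α : ℝ} (hd : P.natDegree ≠ 0)
    (hP : IsCoprime P (derivative P)) (hα₀ : α ≠ 0) (hα₁ : α < P.natDegree) :
    ∃ ψ : (ℂ[X][Y] ⧸ Ideal.span {scaledSymbol P α}) →ₐ[ℂ] RatFunc ℂ,
      Function.Injective ψ ∧ ∃ u, ψ u = RatFunc.X := by
  have hP0 : P ≠ 0 := by rintro rfl; simp at hd
  have hP'0 : derivative P ≠ 0 := by
    intro h
    exact hd (derivative_eq_zero.1 h)
  have hα : (α : ℂ) ≠ 0 := by exact_mod_cast hα₀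
  set F := scaledSymbol P α with hF
  let p : RatFunc ℂ := algebraMap ℂ[X] (RatFunc ℂ) P
  let p' : RatFunc ℂ := algebraMap ℂ[X] (RatFunc ℂ) (derivative P)
  let a : RatFunc ℂ := algebraMap ℂ (RatFunc ℂ) α
  have hp : p ≠ 0 := by simpa [p] using hP0
  have hp' : p' ≠ 0 := by simpa [p'] using hP'0
  have ha : a ≠ 0 := by
    simpa [a] using hα
  let w : RatFunc ℂ := p' / (a * p)
  let v : RatFunc ℂ := a * p / p'
  have hwv : w * v = 1 := by simp only [w, v]; field_simp
  let φ : ℂ[X][Y] →ₐ[ℂ] RatFunc ℂ := aevalAeval (R := ℂ) (RatFunc.X - v) w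
  have hφF : φ F = 0 := by
    change aevalAeval (R := ℂ) (RatFunc.X - v) w (scaledSymbol P α) = 0
    rw [aevalAeval_scaledSymbol hd α hwv, sub_add_cancel, RatFunc.aeval_X_left_eq_algebraMap,
      RatFunc.aeval_X_left_eq_algebraMap]
    change w ^ _ * (a * w * p - p') = 0
    have : a * w * p - p' = 0 := by simp only [w]; field_simp; ring
    rw [this, mul_zero]
  have hφ : ∀ G ∈ Ideal.span {F}, φ G = 0 := by
    intro G hG
    obtain ⟨H, rfl⟩ := Ideal.mem_span_singleton.1 hG
    rw [map_mul, hφF, zero_mul]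
  let ψ : (ℂ[X][Y] ⧸ Ideal.span {F}) →ₐ[ℂ] RatFunc ℂ := Ideal.Quotient.liftₐ _ φ hφ
  let π : ℂ[X][Y] →ₐ[ℂ] (ℂ[X][Y] ⧸ Ideal.span {F}) := Ideal.Quotient.mkₐ ℂ _
  have hψπ : ∀ G, ψ (π G) = φ G := fun G => Ideal.Quotient.liftₐ_apply _ φ hφ _
  have hπF : π F = 0 := by
    exact Ideal.Quotient.eq_zero_iff_mem.2 (Ideal.mem_span_singleton_self F)
  obtain ⟨v', u, hv', hu, hfrac⟩ :=
    exists_unit_fraction_of_scaledSymbol_eq_zero (A := ℂ[X][Y] ⧸ Ideal.span {F}) hd hP hα₀ hα₁ π hπF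
  have hψy : ψ (π X) = w := by
    rw [hψπ]
    exact aevalAeval_Y _ _
  have hψx : ψ (π (C X)) = RatFunc.X - v := by
    rw [hψπ]
    exact aevalAeval_X _ _
  have hw0 : w ≠ 0 := left_ne_zero_of_mul_eq_one hwv
  have hψv : ψ v' = v := by
    apply mul_left_cancel₀ hw0
    rw [hwv, ← hψy, ← map_mul, hv', map_one]
  have hψu : ψ u = RatFunc.X := by
    rw [hu, map_add, hψx, hψv, sub_add_cancel]
  refine ⟨ψ, ?_, u, hψu⟩
  rw [injective_iff_map_eq_zero]
  intro b hb
  obtain ⟨G, rfl⟩ := Ideal.Quotient.mkₐ_surjective ℂ (Ideal.span {F}) b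
  -- Up to a unit, an element of the kernel is `g(u)`. Since `u` maps to the transcendental
  -- `RatFunc.X`, the polynomial `g` is zero, hence so is the element.
  obtain ⟨n, g, hg, hg0⟩ := hfrac G
  have hb' : ψ (π G) = 0 := hb
  have h0 : aeval (RatFunc.X : RatFunc ℂ) g = 0 := by
    rw [← hψu, aeval_algHom_apply, ← hg, map_mul, hb', mul_zero]
  rw [RatFunc.aeval_X_left_eq_algebraMap] at h0
  exact hg0 <| RatFunc.algebraMap_injective ℂ (by rw [h0, map_zero])

/-- A ring that embeds into a field is a domain, so the polynomial is prime. -/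
theorem irreducible_scaledSymbol {P : ℂ[X]} {α : ℝ} (hd : P.natDegree ≠ 0)
    (hP : IsCoprime P (derivative P)) (hα₀ : α ≠ 0) (hα₁ : α < P.natDegree) :
    Irreducible (scaledSymbol P α) := by
  obtain ⟨ψ, hψ, -⟩ := exists_injective_algHom_ratFunc hd hP hα₀ hα₁
  have hP0 : P ≠ 0 := by rintro rfl; simp at hd
  have hF0 : scaledSymbol P α ≠ 0 := by
    intro h
    apply evalEval_scaledSymbol_zero_ne hP0 hα₁ 0
    rw [h, evalEval_zero]
  have hdom := Function.Injective.isDomain ψ hψ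
  rw [Ideal.Quotient.isDomain_iff_prime, Ideal.span_singleton_prime hF0] at hdom
  exact hdom.irreducible

/-- The image of `ψ` contains `RatFunc.X`, hence all polynomials, and every rational function is a
quotient of two of them. -/
theorem nonempty_fractionRing_algEquiv_ratFunc {A : Type*} [CommRing A] [Algebra ℂ A]
    (ψ : A →ₐ[ℂ] RatFunc ℂ) (hψ : Function.Injective ψ) {u : A} (hu : ψ u = RatFunc.X) :
    Nonempty (FractionRing A ≃ₐ[ℂ] RatFunc ℂ) := by
  let _ : Algebra A (RatFunc ℂ) := ψ.toRingHom.toAlgebra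
  have _ : FaithfulSMul A (RatFunc ℂ) :=
    (faithfulSMul_iff_algebraMap_injective _ _).2 hψ
  have _ : IsFractionRing A (RatFunc ℂ) := by
    refine IsFractionRing.of_field _ _ fun f => ⟨aeval u f.num, aeval u f.denom, ?_⟩
    have h : ∀ g : ℂ[X], algebraMap A (RatFunc ℂ) (aeval u g) = algebraMap ℂ[X] (RatFunc ℂ) g :=
        fun g => by
      change ψ (aeval u g) = _
      rw [← aeval_algHom_apply, hu, RatFunc.aeval_X_left_eq_algebraMap]
    rw [h, h, RatFunc.num_div_denom]
  refine ⟨AlgEquiv.ofRingEquiv (f := (FractionRing.algEquiv A (RatFunc ℂ)).toRingEquiv) fun c => ?_⟩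
  rw [IsScalarTower.algebraMap_apply ℂ A (FractionRing A)]
  exact ((FractionRing.algEquiv A (RatFunc ℂ)).commutes _).trans (ψ.commutes c)

theorem isRationalCurve_scaledSymbol {P : ℂ[X]} {α : ℝ} (hd : P.natDegree ≠ 0)
    (hP : IsCoprime P (derivative P)) (hα₀ : α ≠ 0) (hα₁ : α < P.natDegree) :
    IsRationalCurve (scaledSymbol P α) := by
  refine ⟨irreducible_scaledSymbol hd hP hα₀ hα₁, ?_⟩
  obtain ⟨ψ, hψ, u, hu⟩ := exists_injective_algHom_ratFunc hd hP hα₀ hα₁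
  exact nonempty_fractionRing_algEquiv_ratFunc ψ hψ hu

/-! ### The slopes at `(∞, 0)` and the singular points -/

theorem differentiable_evalEval (G : ℂ[X][Y]) :
    Differentiable ℂ fun x : ℂ × ℂ => G.evalEval x.1 x.2 := by
  induction G using Polynomial.induction_on with
  | C p =>
    simp only [evalEval_C]
    exact p.differentiable.comp differentiable_fst
  | add p q hp hq =>
    simp only [evalEval_add]
    exact hp.add hq
  | monomial n c h =>
    have h1 : ∀ x : ℂ × ℂ, (C c * X ^ (n + 1) : ℂ[X][Y]).evalEval x.1 x.2
        = (C c * X ^ n : ℂ[X][Y]).evalEval x.1 x.2 * x.2 := fun x => by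
      rw [pow_succ, ← mul_assoc, evalEval_mul, evalEval_X]
    simp only [h1]
    exact h.mul differentiable_snd

/-- On each line `w = s y` the function is divisible by `y ^ m` with `m ≥ 2`, so its derivative in
the direction `(1, s)` vanishes; two such directions span the plane. -/
theorem HasSlopePolynomial.fderiv_eq_zero {G : ℂ[X][Y]} {m : ℕ} {q : ℂ[X]}
    (h : HasSlopePolynomial G m q) (hm : 2 ≤ m) :
    fderiv ℂ (fun x : ℂ × ℂ => G.evalEval x.1 x.2) (0, 0) = 0 := by
  obtain ⟨-, R, hR⟩ := h
  have key : ∀ s : ℂ, fderiv ℂ (fun x : ℂ × ℂ => G.evalEval x.1 x.2) (0, 0) (1, s) = 0 := by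
    intro s
    have h1 : HasDerivAt (fun t : ℂ => ((t, s * t) : ℂ × ℂ)) (1, s) 0 := by
      simpa using (hasDerivAt_id (0 : ℂ)).prodMk ((hasDerivAt_id (0 : ℂ)).const_mul s)
    have h2 : HasDerivAt (fun t : ℂ => G.evalEval t (s * t))
        (fderiv ℂ (fun x : ℂ × ℂ => G.evalEval x.1 x.2) (0, 0) (1, s)) 0 := by
      have h3 := (differentiable_evalEval G (0, 0)).hasFDerivAt
      have h4 : ((0 : ℂ), s * (0 : ℂ)) = (0, 0) := by rw [mul_zero]
      rw [← h4] at h3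
      have h5 := h3.comp_hasDerivAt 0 h1
      rw [h4] at h5
      exact h5
    have h6 : HasDerivAt (fun t : ℂ => t ^ m * (q.eval s + t * R.evalEval t s)) 0 0 := by
      have h7 : DifferentiableAt ℂ (fun t : ℂ => q.eval s + t * R.evalEval t s) 0 := by
        have h8 : Differentiable ℂ fun t : ℂ => R.evalEval t s :=
          (differentiable_evalEval R).comp (g := fun x : ℂ × ℂ => R.evalEval x.1 x.2)
            (differentiable_id.prodMk (differentiable_const s))
        exact ((differentiable_const _).add (differentiable_id.mul h8)) 0
      have h9 := (hasDerivAt_pow m (0 : ℂ)).mul h7.hasDerivAt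
      rw [zero_pow (by omega), zero_pow (by omega)] at h9
      have h10 : (m : ℂ) * 0 * (q.eval s + 0 * R.evalEval 0 s) + 0 *
        deriv (fun t : ℂ => q.eval s + t * R.evalEval t s) 0 = 0 := by ring
      rw [h10] at h9
      exact h9
    exact h2.unique (h6.congr_of_eventuallyEq (Eventually.of_forall fun t => hR t s))
  ext
  · simpa using key 0
  · have h : ((0 : ℂ), (1 : ℂ)) = (1, 1) - (1, 0) := by simp
    have h' := map_sub (fderiv ℂ (fun x : ℂ × ℂ => G.evalEval x.1 x.2) (0, 0)) (1, 1) (1, 0)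
    rw [key 1, key 0, ← h] at h'
    simpa using h'

/-! ### The equation at `(∞, 0)` and its terms of lowest degree. -/

theorem coeff_swap_scaledSymbol_natDegree (P : ℂ[X]) (α : ℝ) :
    (Bivariate.swap (scaledSymbol P α)).coeff P.natDegree
      = C (α * P.leadingCoeff : ℂ) * X ^ P.natDegree := by
  rw [scaledSymbol, map_sum, finsetSum_coeff, Finset.sum_eq_single 0]
  · rw [map_mul, map_pow, Bivariate.swap_C, Bivariate.swap_Y, ← C_pow, coeff_mul_C, coeff_map]
    simp
  · intro k hk hk0
    rw [map_mul, map_pow, Bivariate.swap_C, Bivariate.swap_Y, ← C_pow, coeff_mul_C, coeff_map,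
      coeff_C_mul, coeff_iterate_derivative, coeff_eq_zero_of_natDegree_lt (by omega)]
    simp
  · intro h
    simp at h

/-- Only the term `k = 0` reaches degree `d` in `z`, with coefficient `α` times a nonzero multiple
of `w ^ d`. So exactly `y ^ d` is cleared by `localEquation` at `z = ∞`. -/
theorem natDegree_swap_scaledSymbol {P : ℂ[X]} (hP : P ≠ 0) {α : ℝ} (hα : α ≠ 0) :
    (Bivariate.swap (scaledSymbol P α)).natDegree = P.natDegree := by
  refine natDegree_eq_of_le_of_coeff_ne_zero ?_ ?_
  · rw [scaledSymbol, map_sum]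
    refine natDegree_sum_le_of_forall_le _ _ fun k _ => ?_
    rw [map_mul, map_pow, Bivariate.swap_C, Bivariate.swap_Y, ← C_pow]
    refine (natDegree_mul_C_le _ _).trans (natDegree_map_le.trans ?_)
    exact (natDegree_C_mul_le _ _).trans ((natDegree_iterate_derivative P k).trans (Nat.sub_le _ _))
  · rw [coeff_swap_scaledSymbol_natDegree]
    simpa using ⟨hα, hP⟩

theorem evalEval_swap (G : ℂ[X][Y]) (x y : ℂ) :
    (Bivariate.swap G).evalEval x y = G.evalEval y x := by
  have := Bivariate.aevalAeval_swap x y G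
  rwa [coe_aevalAeval_eq_evalEval, coe_aevalAeval_eq_evalEval] at this

theorem evalEval_reverse (G : ℂ[X][Y]) (x : ℂ) {y : ℂ} (hy : y ≠ 0) :
    G.reverse.evalEval x y = y ^ G.natDegree * G.evalEval x y⁻¹ := by
  let _ := invertibleOfNonzero (inv_ne_zero hy)
  have := eval₂_reverse_mul_pow (evalRingHom x) y⁻¹ G
  rw [invOf_eq_inv, inv_inv, eval₂_evalRingHom] at this
  rw [← this, inv_pow]
  field_simp

theorem localEquation_infty_coe (F : ℂ[X][Y]) (w : ℂ) :
    localEquation F (OnePoint.infty, (w : OnePoint ℂ))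
      = Bivariate.swap (Bivariate.swap F).reverse := by
  simp [localEquation]

theorem evalEval_localEquation_infty_coe {P : ℂ[X]} (hP : P ≠ 0) {α : ℝ} (hα : α ≠ 0)
    (w₀ : ℂ) {y : ℂ} (hy : y ≠ 0) (w : ℂ) :
    (localEquation (scaledSymbol P α) (OnePoint.infty, (w₀ : OnePoint ℂ))).evalEval y w
      = y ^ P.natDegree * (scaledSymbol P α).evalEval y⁻¹ w := by
  rw [localEquation_infty_coe, evalEval_swap, evalEval_reverse _ _ hy, evalEval_swap,
    natDegree_swap_scaledSymbol hP hα]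

/-- Needed separately because `evalEval_localEquation_infty_coe` excludes `y = 0`; there only the
top coefficient in `z`, a multiple of `w ^ d`, survives. -/
theorem evalEval_localEquation_infty_zero {P : ℂ[X]} (hd : P.natDegree ≠ 0) {α : ℝ} (hα : α ≠ 0) :
    (localEquation (scaledSymbol P α) (OnePoint.infty, ((0 : ℂ) : OnePoint ℂ))).evalEval 0 0
      = 0 := by
  have hP : P ≠ 0 := by rintro rfl; simp at hd
  rw [localEquation_infty_coe, evalEval_swap, evalEval, C_0,
    ← coeff_zero_eq_eval_zero (reverse _), coeff_zero_reverse, leadingCoeff, natDegree_swap_scaledSymbol hP hα,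
    coeff_swap_scaledSymbol_natDegree]
  simp [hd]

theorem eval_reflect {Q : ℂ[X]} {n : ℕ} (h : Q.natDegree ≤ n) {y : ℂ} (hy : y ≠ 0) :
    (reflect n Q).eval y = y ^ n * Q.eval y⁻¹ := by
  let _ := invertibleOfNonzero (inv_ne_zero hy)
  have := eval₂_reflect_mul_pow (RingHom.id ℂ) y⁻¹ n Q h
  rw [invOf_eq_inv, inv_inv] at this
  simp only [eval₂_id] at this
  rw [← this, inv_pow]
  field_simp

/-- This is `sum_sub_mul_iterate_derivative` for the polynomial `X ^ d` at `z = s`, `t = 1`. The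
terms of lowest degree at `(∞, 0)` depend on `P` only through its leading term, which is why the
monomial suffices. -/
theorem sum_slopes (d : ℕ) (α : ℝ) (s : ℂ) :
    ∑ k ∈ Finset.range (d + 1), ((α : ℂ) - k) / k.factorial * d.descFactorial k * s ^ (d - k)
      = α * (s + 1) ^ d - d * (s + 1) ^ (d - 1) := by
  have := sum_sub_mul_iterate_derivative (A := ℂ) (X ^ d : ℂ[X]) α s 1
  rw [natDegree_X_pow] at this
  simp only [iterate_derivative_X_pow_eq_natCast_mul, coe_aeval_eq_eval, eval_mul, eval_natCast,
    eval_pow, eval_X, derivative_X_pow, eval_C, Algebra.algebraMap_self_apply, one_pow, mul_one,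
    one_mul] at this
  rw [← this]
  exact Finset.sum_congr rfl fun k _ => by ring

/-- For `z = 1/y`, `w = s y`, the `k`-th term contains `y^(d-k) P^(k)(1/y)`, the reflected
polynomial. Its constant coefficient is the leading coefficient of `P` times `d!/(d-k)!` and
contributes to the slope polynomial; `divX` of it goes into the remainder. -/
theorem hasSlopePolynomial_scaledSymbol {P : ℂ[X]} {d : ℕ} (hdeg : P.natDegree = d) (hd : 1 ≤ d)
    {α : ℝ} (hα : α ≠ 0) :
    HasSlopePolynomial
      (localEquation (scaledSymbol P α) (OnePoint.infty, ((0 : ℂ) : OnePoint ℂ))) d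
      (C P.leadingCoeff * ((X + 1) ^ (d - 1) * (C (α : ℂ) * (X + 1) - C (d : ℂ)))) := by
  have hP : P ≠ 0 := by rintro rfl; simp at hdeg; omega
  have hα' : (α : ℂ) ≠ 0 := by exact_mod_cast hα
  have hd' : (d : ℂ) ≠ 0 := by exact_mod_cast (by omega : d ≠ 0)
  refine ⟨?_, ∑ k ∈ Finset.range (d + 1), C (C (((α : ℂ) - k) / (k.factorial : ℂ)) *
    divX (reflect (d - k) (derivative^[k] P))) * X ^ (d - k), fun y s => ?_⟩
  · intro h
    -- Vanishing at `0` and at `1` would give `α = d` and `2 α = d`, hence `α = 0`.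
    have h1 := congrArg (eval (0 : ℂ)) h
    have h2 := congrArg (eval (1 : ℂ)) h
    simp only [eval_mul, eval_C, eval_pow, eval_add, eval_X, eval_one, eval_sub, eval_zero,
      mul_eq_zero, leadingCoeff_eq_zero, hP, false_or, zero_add, one_pow, one_ne_zero, mul_one,
      pow_eq_zero_iff'] at h1 h2
    norm_num at h2
    apply hα'
    linear_combination h2 - h1
  · by_cases hy : y = 0
    · rw [hy, mul_zero, evalEval_localEquation_infty_zero (by omega) hα, zero_pow (by omega),
        zero_mul]
    rw [evalEval_localEquation_infty_coe hP hα _ hy, hdeg]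
    congr 1
    have h1 := aevalAeval_scaledSymbol_eq_sum (A := ℂ) P α y⁻¹ (s * y)
    rw [coe_aevalAeval_eq_evalEval, hdeg] at h1
    have h2 : eval s (C P.leadingCoeff * ((X + 1) ^ (d - 1) * (C (α : ℂ) * (X + 1) - C (d : ℂ))))
        = P.leadingCoeff * (α * (s + 1) ^ d - d * (s + 1) ^ (d - 1)) := by
      have h3 : (s + 1) ^ d = (s + 1) ^ (d - 1) * (s + 1) := by
        rw [← pow_succ, Nat.sub_add_cancel hd]
      rw [h3]
      simp only [eval_mul, eval_C, eval_pow, eval_add, eval_X, eval_one, eval_sub]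
      ring
    rw [h1, h2, ← sum_slopes, evalEval_finsetSum, Finset.mul_sum, Finset.mul_sum,
      ← Finset.sum_add_distrib]
    refine Finset.sum_congr rfl fun k hk => ?_
    have hk' : k ≤ d := Nat.lt_succ_iff.1 (Finset.mem_range.1 hk)
    have h4 : (derivative^[k] P).natDegree ≤ d - k := hdeg ▸ natDegree_iterate_derivative P k
    have h5 := eval_reflect h4 hy
    have h6 : (reflect (d - k) (derivative^[k] P)).coeff 0 = d.descFactorial k * P.leadingCoeff := by
      rw [coeff_reflect, revAt_le (Nat.zero_le _), Nat.sub_zero, coeff_iterate_derivative,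
        Nat.sub_add_cancel hk', leadingCoeff, hdeg, nsmul_eq_mul]
    have h7 := congrArg (eval y) (X_mul_divX_add (reflect (d - k) (derivative^[k] P)))
    rw [h5, h6, eval_add, eval_mul, eval_X, eval_C] at h7
    rw [evalEval_mul, evalEval_C, evalEval_pow, evalEval_X, eval_mul, eval_C, coe_aeval_eq_eval,
      mul_pow, Algebra.algebraMap_self_apply]
    linear_combination -(((α : ℂ) - k) / k.factorial) * s ^ (d - k) * h7

theorem roots_slopes {d : ℕ} {α : ℝ} (hα : α ≠ 0) :
    ((X + 1) ^ (d - 1) * (C (α : ℂ) * (X + 1) - C (d : ℂ)) : ℂ[X]).roots =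
      ((d : ℂ) / α - 1) ::ₘ Multiset.replicate (d - 1) (-1) := by
  have hα' : (α : ℂ) ≠ 0 := by exact_mod_cast hα
  have h1 : (X + 1 : ℂ[X]) = X - C (-1) := by simp
  have h2 : (C (α : ℂ) * (X + 1) - C (d : ℂ) : ℂ[X]) = C (α : ℂ) * (X - C ((d : ℂ) / α - 1)) := by
    have : (C (d : ℂ) : ℂ[X]) = C (α : ℂ) * C ((d : ℂ) / α) := by
      rw [← C_mul, mul_div_cancel₀ _ hα']
    rw [this, C_sub, C_1]
    ring
  have h3 : (C (α : ℂ) * (X - C ((d : ℂ) / α - 1)) : ℂ[X]) ≠ 0 :=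
    mul_ne_zero (C_ne_zero.2 hα') (X_sub_C_ne_zero _)
  rw [h2, roots_mul (mul_ne_zero (pow_ne_zero _ (h1 ▸ X_sub_C_ne_zero _)) h3), h1, roots_pow,
    roots_X_sub_C, roots_C_mul _ hα', roots_X_sub_C, Multiset.nsmul_singleton, add_comm,
    Multiset.singleton_add]

/-- Differentiate along the curve `z + 1/w = u` with `u` fixed. There the symbol is `t^(d-1) (α t
P(u) - P'(u))`, whose derivative at its zero `t = w` is `w^(d-1) α P(u)`; coprimality gives `P(u) ≠
0`. -/
theorem fderiv_scaledSymbol_ne_zero {P : ℂ[X]} (hd : P.natDegree ≠ 0)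
    (hP : IsCoprime P (derivative P)) {α : ℝ} (hα₀ : α ≠ 0) (hα₁ : α < P.natDegree)
    {z w : ℂ} (h : (scaledSymbol P α).evalEval z w = 0) :
    fderiv ℂ (fun x : ℂ × ℂ => (scaledSymbol P α).evalEval x.1 x.2) (z, w) ≠ 0 := by
  have hP0 : P ≠ 0 := by rintro rfl; simp at hd
  have hw : w ≠ 0 := by
    rintro rfl
    exact evalEval_scaledSymbol_zero_ne hP0 hα₁ z h
  have hα : (α : ℂ) ≠ 0 := by exact_mod_cast hα₀
  rw [evalEval_scaledSymbol hd α z hw] at h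
  set u := z + w⁻¹ with hu
  have h1 : α * w * P.eval u - (derivative P).eval u = 0 :=
    (mul_eq_zero.1 h).resolve_left (pow_ne_zero _ hw)
  have hPu : P.eval u ≠ 0 := by
    intro h2
    obtain ⟨r, s, hrs⟩ := hP
    have h3 := congrArg (eval u) hrs
    rw [h2, mul_zero, zero_sub, neg_eq_zero] at h1
    simp [h1, h2] at h3
  intro h0
  have hz : u - w⁻¹ = z := by rw [hu]; ring
  have h4 : HasDerivAt (fun t : ℂ => ((u - t⁻¹, t) : ℂ × ℂ)) ((w ^ 2)⁻¹, 1) w := by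
    have h5 : HasDerivAt (fun t : ℂ => u - t⁻¹) ((w ^ 2)⁻¹) w := by
      simpa using (hasDerivAt_inv hw).const_sub u
    exact h5.prodMk (hasDerivAt_id w)
  have h6 : HasDerivAt (fun t : ℂ => (scaledSymbol P α).evalEval (u - t⁻¹) t) 0 w := by
    have h7 := (differentiable_evalEval (scaledSymbol P α) (z, w)).hasFDerivAt
    rw [h0, ← hz] at h7
    exact h7.comp_hasDerivAt (f := fun t : ℂ => (u - t⁻¹, t)) w h4
  have h8 : HasDerivAt (fun t : ℂ => t ^ (P.natDegree - 1) *
      (α * t * P.eval u - (derivative P).eval u)) (w ^ (P.natDegree - 1) * (α * P.eval u)) w := by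
    have h9 : HasDerivAt (fun t : ℂ => α * t * P.eval u - (derivative P).eval u)
        (α * P.eval u) w := by
      simpa using (((hasDerivAt_id w).const_mul (α : ℂ)).mul_const (P.eval u)).sub_const
        ((derivative P).eval u)
    have h10 := (hasDerivAt_pow (P.natDegree - 1) w).mul h9
    rwa [h1, mul_zero, zero_add] at h10
  have h11 := h6.unique (h8.congr_of_eventuallyEq ?_)
  · exact mul_ne_zero (pow_ne_zero _ hw) (mul_ne_zero hα hPu) h11.symm
  · filter_upwards [isOpen_ne.mem_nhds hw] with t ht
    rw [evalEval_scaledSymbol hd α _ ht, sub_add_cancel]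

/-- On the line `w = ∞` the reversed equation restricts to `α P(z)`, so its `z`-derivative is `α
P'(z)`. -/
theorem fderiv_reverse_scaledSymbol_ne_zero {P : ℂ[X]} (hP : P ≠ 0) {α : ℝ} (hα₀ : α ≠ 0) {z : ℂ}
    (h : (derivative P).eval z ≠ 0) :
    fderiv ℂ (fun x : ℂ × ℂ => (scaledSymbol P α).reverse.evalEval x.1 x.2) (z, 0) ≠ 0 := by
  intro h0
  have hα : (α : ℂ) ≠ 0 := by exact_mod_cast hα₀
  have h4 : HasDerivAt (fun t : ℂ => ((t, 0) : ℂ × ℂ)) (1, 0) z :=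
    (hasDerivAt_id z).prodMk (hasDerivAt_const z 0)
  have h6 : HasDerivAt (fun t : ℂ => (scaledSymbol P α).reverse.evalEval t 0) 0 z := by
    have h7 := (differentiable_evalEval (scaledSymbol P α).reverse (z, 0)).hasFDerivAt
    rw [h0] at h7
    exact h7.comp_hasDerivAt (f := fun t : ℂ => (t, (0 : ℂ))) z h4
  have h8 : HasDerivAt (fun t : ℂ => α * P.eval t) (α * (derivative P).eval z) z :=
    (P.hasDerivAt z).const_mul _
  refine mul_ne_zero hα h (h6.unique (h8.congr_of_eventuallyEq (Eventually.of_forall fun t => ?_))).symm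
  change evalEval t 0 _ = _
  rw [evalEval, C_0, ← coeff_zero_eq_eval_zero, coeff_zero_reverse, leadingCoeff_scaledSymbol hP hα₀,
    eval_mul, eval_C]

/-! ### Holomorphic maps of the Riemann sphere -/

namespace RiemannSphere

theorem finiteChart_coe (z : ℂ) : finiteChart (z : OnePoint ℂ) = z :=
  (OnePoint.isOpenEmbedding_coe.toOpenPartialHomeomorph ((↑) : ℂ → OnePoint ℂ)).left_inv
    (Set.mem_univ z)

theorem finiteChart_symm_apply (z : ℂ) : finiteChart.symm z = (z : OnePoint ℂ) := rfl

theorem coe_mem_finiteChart_source (z : ℂ) : (z : OnePoint ℂ) ∈ finiteChart.source := by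
  simp [finiteChart]

theorem inftyChart_apply (x : OnePoint ℂ) : inftyChart x = finiteChart (inv x) := rfl

theorem inftyChart_symm_apply (z : ℂ) : inftyChart.symm z = inv (z : OnePoint ℂ) := rfl

theorem inftyChart_inv_coe (z : ℂ) : inftyChart (inv (z : OnePoint ℂ)) = z := by
  rw [inftyChart_apply, inv_involutive, finiteChart_coe]

theorem mem_inftyChart_source {x : OnePoint ℂ} :
    x ∈ inftyChart.source ↔ inv x ∈ finiteChart.source := by
  simp only [inftyChart, OpenPartialHomeomorph.trans_source,
    Homeomorph.toOpenPartialHomeomorph_source, Set.univ_inter]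
  rfl

theorem inv_coe_mem_inftyChart_source (z : ℂ) : inv (z : OnePoint ℂ) ∈ inftyChart.source := by
  rw [mem_inftyChart_source, inv_involutive]
  exact coe_mem_finiteChart_source z

theorem inv_coe_zero : inv ((0 : ℂ) : OnePoint ℂ) = OnePoint.infty := by
  simp [inv_coe]

theorem inv_coe_of_ne_zero {z : ℂ} (hz : z ≠ 0) :
    inv (z : OnePoint ℂ) = ((z⁻¹ : ℂ) : OnePoint ℂ) := by
  simp [inv_coe, hz]

theorem finiteChart_mem_atlas : finiteChart ∈ atlas ℂ (OnePoint ℂ) := Set.mem_insert _ _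

theorem inftyChart_mem_atlas : inftyChart ∈ atlas ℂ (OnePoint ℂ) :=
  Set.mem_insert_of_mem _ rfl

theorem chartAt_coe (z : ℂ) : chartAt ℂ (z : OnePoint ℂ) = finiteChart :=
  if_neg (OnePoint.coe_ne_infty z)

theorem chartAt_infty : chartAt ℂ (OnePoint.infty : OnePoint ℂ) = inftyChart :=
  if_pos rfl

theorem chartAt_coe_apply_self (z : ℂ) : chartAt ℂ (z : OnePoint ℂ) (z : OnePoint ℂ) = z := by
  rw [chartAt_coe, finiteChart_coe]

theorem chartAt_infty_apply_self :
    chartAt ℂ (OnePoint.infty : OnePoint ℂ) (OnePoint.infty : OnePoint ℂ) = 0 := by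
  rw [chartAt_infty, inftyChart_apply, inv_infty, finiteChart_coe]

theorem nhds_infty_eq_map : 𝓝 (OnePoint.infty : OnePoint ℂ)
    = map (fun t : ℂ => inv (t : OnePoint ℂ)) (𝓝 0) := by
  have h := invHomeomorph.map_nhds_eq ((0 : ℂ) : OnePoint ℂ)
  rw [OnePoint.nhds_coe_eq, map_map] at h
  rw [← inv_coe_zero]
  exact h.symm

theorem coord_coe (z : ℂ) : coord (z : OnePoint ℂ) = z := rfl

theorem coord_infty : coord OnePoint.infty = 0 := rfl

theorem contDiffAt_chart_inv {z : ℂ} (hz : inv (z : OnePoint ℂ) ∈ finiteChart.source) :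
    ContDiffAt ℂ ω (fun t : ℂ => finiteChart (inv (t : OnePoint ℂ))) z := by
  have hz0 : z ≠ 0 := by
    rintro rfl
    rw [inv_coe_zero] at hz
    simp [finiteChart] at hz
  refine (contDiffAt_inv ℂ hz0).congr_of_eventuallyEq ?_
  filter_upwards [isOpen_ne.mem_nhds hz0] with t ht
  rw [inv_coe_of_ne_zero ht, finiteChart_coe]

instance : IsManifold 𝓘(ℂ) ω (OnePoint ℂ) := by
  refine isManifold_of_contDiffOn _ _ _ fun e e' he he' => ?_
  rintro z ⟨hz, -⟩
  refine ContDiffAt.contDiffWithinAt ?_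
  have hz' : z ∈ (e.symm ≫ₕ e').source := hz
  rw [OpenPartialHomeomorph.trans_source] at hz'
  change ContDiffAt ℂ ω (fun t : ℂ => e' (e.symm t)) z
  have he'z : e.symm z ∈ e'.source := hz'.2
  rcases he with rfl | rfl <;> rcases he' with rfl | rfl
  · simp only [finiteChart_symm_apply, finiteChart_coe]
    exact contDiffAt_id
  · simp only [finiteChart_symm_apply, inftyChart_apply]
    exact contDiffAt_chart_inv (mem_inftyChart_source.1 he'z)
  · simp only [inftyChart_symm_apply]
    exact contDiffAt_chart_inv he'z
  · simp only [inftyChart_symm_apply, inftyChart_inv_coe]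
    exact contDiffAt_id

theorem mdifferentiable_coe : MDifferentiable 𝓘(ℂ) 𝓘(ℂ) ((↑) : ℂ → OnePoint ℂ) := fun z =>
  mdifferentiableAt_atlas_symm (I := 𝓘(ℂ)) finiteChart_mem_atlas
    (finiteChart_coe z ▸ finiteChart.map_source (coe_mem_finiteChart_source z))

theorem mdifferentiable_inv_coe :
    MDifferentiable 𝓘(ℂ) 𝓘(ℂ) fun z : ℂ => inv (z : OnePoint ℂ) := fun z =>
  mdifferentiableAt_atlas_symm (I := 𝓘(ℂ)) inftyChart_mem_atlas
    (inftyChart_inv_coe z ▸ inftyChart.map_source (inv_coe_mem_inftyChart_source z))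

theorem mdifferentiableAt_coe_of_comp {f : OnePoint ℂ → OnePoint ℂ} {z : ℂ}
    (h : MDifferentiableAt 𝓘(ℂ) 𝓘(ℂ) (fun t : ℂ => f (t : OnePoint ℂ)) z) :
    MDifferentiableAt 𝓘(ℂ) 𝓘(ℂ) f (z : OnePoint ℂ) := by
  have h1 := mdifferentiableAt_atlas (I := 𝓘(ℂ)) finiteChart_mem_atlas
    (coe_mem_finiteChart_source z)
  rw [← finiteChart_coe z] at h
  refine (h.comp (z : OnePoint ℂ) h1).congr_of_eventuallyEq ?_
  rw [OnePoint.nhds_coe_eq, EventuallyEq, eventually_map]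
  exact Eventually.of_forall fun t => by simp [finiteChart_coe]

theorem mdifferentiableAt_infty_of_comp {f : OnePoint ℂ → OnePoint ℂ}
    (h : MDifferentiableAt 𝓘(ℂ) 𝓘(ℂ) (fun t : ℂ => f (inv (t : OnePoint ℂ))) 0) :
    MDifferentiableAt 𝓘(ℂ) 𝓘(ℂ) f OnePoint.infty := by
  have h1 := mdifferentiableAt_atlas (I := 𝓘(ℂ)) inftyChart_mem_atlas
    (inv_coe_mem_inftyChart_source 0)
  rw [← inftyChart_inv_coe 0] at h
  have h2 := h.comp (inv ((0 : ℂ) : OnePoint ℂ)) h1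
  rw [inv_coe_zero] at h2
  refine h2.congr_of_eventuallyEq ?_
  rw [nhds_infty_eq_map, EventuallyEq, eventually_map]
  exact Eventually.of_forall fun t => by simp [inftyChart_inv_coe]

/-! ### Points of the sphere given by homogeneous coordinates. -/

open Classical in
/-- The point `a / b` of the Riemann sphere, with homogeneous coordinates `[a : b]`. -/
noncomputable def ratio (a b : ℂ) : OnePoint ℂ :=
  if b = 0 then OnePoint.infty else ((a / b : ℂ) : OnePoint ℂ)

theorem ratio_zero_right (a : ℂ) : ratio a 0 = OnePoint.infty := if_pos rfl

theorem ratio_of_ne_zero (a : ℂ) {b : ℂ} (hb : b ≠ 0) :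
    ratio a b = ((a / b : ℂ) : OnePoint ℂ) := if_neg hb

theorem ratio_eq_infty {a b : ℂ} : ratio a b = OnePoint.infty ↔ b = 0 := by
  by_cases h : b = 0 <;> simp [ratio, h]

/-- For `b = 0` both sides are `0`: `coord` takes this value at `∞`, and `a / 0 = 0`. -/
theorem coord_ratio (a b : ℂ) : coord (ratio a b) = a / b := by
  by_cases h : b = 0
  · rw [h, ratio_zero_right, coord_infty, div_zero]
  · rw [ratio_of_ne_zero _ h, coord_coe]

theorem ratio_eq_inv {a : ℂ} (ha : a ≠ 0) (b : ℂ) :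
    ratio a b = inv ((b / a : ℂ) : OnePoint ℂ) := by
  by_cases h : b = 0
  · rw [h, ratio_zero_right, zero_div, inv_coe_zero]
  · rw [ratio_of_ne_zero _ h, inv_coe_of_ne_zero (div_ne_zero h ha), inv_div]

theorem ratio_mul_left {c : ℂ} (hc : c ≠ 0) (a b : ℂ) : ratio (c * a) (c * b) = ratio a b := by
  by_cases h : b = 0
  · rw [h, mul_zero, ratio_zero_right, ratio_zero_right]
  · rw [ratio_of_ne_zero _ h, ratio_of_ne_zero _ (mul_ne_zero hc h), mul_div_mul_left _ _ hc]

theorem mdifferentiableAt_ratio {p q : ℂ → ℂ} {z : ℂ} (hp : DifferentiableAt ℂ p z)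
    (hq : DifferentiableAt ℂ q z) (h : p z ≠ 0 ∨ q z ≠ 0) :
    MDifferentiableAt 𝓘(ℂ) 𝓘(ℂ) (fun t => ratio (p t) (q t)) z := by
  rcases h with h | h
  · have h1 : MDifferentiableAt 𝓘(ℂ) 𝓘(ℂ) (fun t => q t / p t) z :=
      (hq.div hp h).mdifferentiableAt
    refine ((mdifferentiable_inv_coe _).comp z h1).congr_of_eventuallyEq ?_
    filter_upwards [hp.continuousAt.eventually_ne h] with t ht
    exact ratio_eq_inv ht _
  · have h1 : MDifferentiableAt 𝓘(ℂ) 𝓘(ℂ) (fun t => p t / q t) z :=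
      (hp.div hq h).mdifferentiableAt
    refine ((mdifferentiable_coe _).comp z h1).congr_of_eventuallyEq ?_
    filter_upwards [hq.continuousAt.eventually_ne h] with t ht
    exact ratio_of_ne_zero _ ht

end RiemannSphere

/-! ### Simple poles and smooth branches -/

section LocalLemmas

/-- Cauchy's integral formula for `g`; small circles miss their centre, so the value of `f` at `x`
is irrelevant. -/
theorem eventually_circleIntegral_div_sub_eq {f g : ℂ → ℂ} {x : ℂ} (hg : AnalyticAt ℂ g x)
    (h : ∀ᶠ t in 𝓝[≠] x, f t = g t / (t - x)) :
    ∀ᶠ ε in 𝓝[>] (0 : ℝ), (2 * Real.pi * Complex.I)⁻¹ * (∮ t in C(x, ε), f t) = g x := by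
  have h1 : ∀ᶠ t in 𝓝 x, AnalyticAt ℂ g t ∧ (t ≠ x → f t = g t / (t - x)) :=
    hg.eventually_analyticAt.and (eventually_nhdsWithin_iff.1 h)
  obtain ⟨r, hr, hball⟩ := Metric.eventually_nhds_iff_ball.1 h1
  filter_upwards [Ioo_mem_nhdsGT hr] with ε hε
  have h2 : (∮ t in C(x, ε), f t) = ∮ t in C(x, ε), (t - x)⁻¹ • g t := by
    refine circleIntegral.integral_congr hε.1.le fun t ht => ?_
    have ht' : dist t x = ε := ht
    have hne : t ≠ x := by
      rintro rfl
      rw [dist_self] at ht'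
      exact hε.1.ne ht'
    rw [(hball t (by rw [Metric.mem_ball, ht']; exact hε.2)).2 hne, smul_eq_mul, div_eq_inv_mul]
  have h3 : DifferentiableOn ℂ g (Metric.closedBall x ε) := fun t ht =>
    (hball t (lt_of_le_of_lt ht hε.2)).1.differentiableAt.differentiableWithinAt
  rw [h2, h3.circleIntegral_sub_inv_smul (Metric.mem_ball_self hε.1), smul_eq_mul, ← mul_assoc,
    inv_mul_cancel₀ Complex.two_pi_I_ne_zero, one_mul]

theorem meromorphicAt_of_eq_div_sub {f g : ℂ → ℂ} {x : ℂ} (hg : AnalyticAt ℂ g x)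
    (h : ∀ᶠ t in 𝓝[≠] x, f t = g t / (t - x)) : MeromorphicAt f x := by
  have h1 : MeromorphicAt (fun t => g t / (t - x)) x :=
    hg.meromorphicAt.fun_div ((analyticAt_id.sub analyticAt_const).meromorphicAt)
  exact h1.congr (h.mono fun t ht => ht.symm)

theorem meromorphicOrderAt_of_eq_div_sub {f g : ℂ → ℂ} {x : ℂ} (hg : AnalyticAt ℂ g x)
    (h : ∀ᶠ t in 𝓝[≠] x, f t = g t / (t - x)) (hx : g x ≠ 0) :
    meromorphicOrderAt f x = ((-1 : ℤ) : WithTop ℤ) := by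
  rw [meromorphicOrderAt_eq_int_iff (meromorphicAt_of_eq_div_sub hg h)]
  refine ⟨g, hg, hx, h.mono fun t ht => ?_⟩
  rw [ht, zpow_neg_one, smul_eq_mul, div_eq_inv_mul]

/-- As `y' ≠ 0`, the function `y` is a local coordinate with an analytic inverse `φ`, and the branch
is the graph of `s ↦ s * k (φ s)`. Writing `w = y k` makes the slope the value `k x`. -/
theorem isSmoothBranchAtInfty_of_parametrisation {M : Type} [TopologicalSpace M] [ChartedSpace ℂ M]
    {ν : M → SphereSq} {p : M} {σ : ℂ → M} {y k : ℂ → ℂ} {x : ℂ} (hσ : map σ (𝓝 x) = 𝓝 p)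
    (hy : AnalyticAt ℂ y x) (hy0 : y x = 0) (hy' : deriv y x ≠ 0) (hk : AnalyticAt ℂ k x)
    (hν : ∀ᶠ t in 𝓝 x, ν (σ t) =
      (RiemannSphere.inv (y t : OnePoint ℂ), ((y t * k t : ℂ) : OnePoint ℂ))) :
    IsSmoothBranchAtInfty ν p (k x) := by
  set φ := hy.hasStrictDerivAt.localInverse _ _ _ hy' with hφ
  have hφa : AnalyticAt ℂ φ 0 := hy0 ▸ hy.analyticAt_localInverse hy'
  have hφ0 : φ 0 = x := by
    rw [← hy0]
    exact HasStrictFDerivAt.localInverse_apply_image ..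
  have hleft : ∀ᶠ t in 𝓝 x, φ (y t) = t := hy.hasStrictDerivAt.eventually_left_inverse hy'
  have hkφ : AnalyticAt ℂ (fun s => k (φ s)) 0 := AnalyticAt.fun_comp (hφ0.symm ▸ hk) hφa
  refine ⟨fun s => s * k (φ s), analyticAt_id.mul hkφ, zero_mul _, ?_, ?_⟩
  · have h1 := (hasDerivAt_id (0 : ℂ)).mul hkφ.differentiableAt.hasDerivAt
    have h2 := h1.deriv
    simp only [id, one_mul, zero_mul, add_zero, hφ0] at h2
    exact h2
  · have h3 : map y (𝓝 x) = 𝓝 0 := hy0 ▸ hy.hasStrictDerivAt.map_nhds_eq hy'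
    rw [← hσ, ← h3, map_map, map_map]
    refine Filter.map_congr ?_
    filter_upwards [hν, hleft] with t ht ht'
    simp only [Function.comp_apply, ht, ht']

end LocalLemmas

/-! ### The rational parametrisation of the curve -/

/-- The conditions on `P` and `α` under which the curve is studied. -/
structure IsGenericSymbol (P : ℂ[X]) (α : ℝ) : Prop where
  two_le : 2 ≤ P.natDegree
  coprime : IsCoprime P (derivative P)
  coprime' : IsCoprime (derivative P) (derivative (derivative P))
  pos : 0 < α
  lt : α < P.natDegree

theorem eval_reverse (Q : ℂ[X]) {t : ℂ} (ht : t ≠ 0) :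
    Q.reverse.eval t = t ^ Q.natDegree * Q.eval t⁻¹ :=
  eval_reflect le_rfl ht

theorem eval_zero_reverse (Q : ℂ[X]) : Q.reverse.eval 0 = Q.leadingCoeff := by
  rw [← coeff_zero_eq_eval_zero, coeff_zero_reverse]

theorem eval_ne_zero_of_isCoprime {P Q : ℂ[X]} (h : IsCoprime P Q) {u : ℂ} (hu : P.eval u = 0) :
    Q.eval u ≠ 0 := by
  intro h2
  obtain ⟨r, s, hrs⟩ := h
  have h3 := congrArg (eval u) hrs
  simp [hu, h2] at h3

/-- The parametrisation `z = u - α P(u) / P'(u)`, `w = P'(u) / (α P(u))` of the closure of the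
curve by `u = z + 1 / w` in the Riemann sphere. -/
noncomputable def symbolParam (P : ℂ[X]) (α : ℝ) : OnePoint ℂ → SphereSq
  | none => (OnePoint.infty, ((0 : ℂ) : OnePoint ℂ))
  | some u => (RiemannSphere.ratio (u * (derivative P).eval u - α * P.eval u) ((derivative P).eval u),
      RiemannSphere.ratio ((derivative P).eval u) (α * P.eval u))

open RiemannSphere in
theorem symbolParam_coe (P : ℂ[X]) (α : ℝ) (u : ℂ) : symbolParam P α (u : OnePoint ℂ) =
    (ratio (u * (derivative P).eval u - α * P.eval u) ((derivative P).eval u),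
      ratio ((derivative P).eval u) (α * P.eval u)) := rfl

theorem symbolParam_infty (P : ℂ[X]) (α : ℝ) : symbolParam P α OnePoint.infty =
    (OnePoint.infty, ((0 : ℂ) : OnePoint ℂ)) := rfl

namespace IsGenericSymbol

open RiemannSphere

variable {P : ℂ[X]} {α : ℝ}

theorem natDegree_ne_zero (h : IsGenericSymbol P α) : P.natDegree ≠ 0 := by
  have := h.two_le
  omega

theorem ne_zero (h : IsGenericSymbol P α) : P ≠ 0 := by
  rintro rfl
  exact h.natDegree_ne_zero natDegree_zero

theorem derivative_ne_zero (h : IsGenericSymbol P α) : derivative P ≠ 0 := fun h0 =>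
  h.natDegree_ne_zero (derivative_eq_zero.1 h0)

theorem alpha_ne_zero (h : IsGenericSymbol P α) : (α : ℂ) ≠ 0 := by
  exact_mod_cast h.pos.ne'

theorem degree_ne_alpha (h : IsGenericSymbol P α) : (P.natDegree : ℂ) - α ≠ 0 := by
  rw [sub_ne_zero]
  exact_mod_cast h.lt.ne'

/-- Put `u = 1/t` and multiply the homogeneous coordinates by `t ^ d`. Since `deg P' = d - 1`, a
factor `t` is left in front of the reverse of `P'`. -/
theorem symbolParam_inv_coe (h : IsGenericSymbol P α) (t : ℂ) :
    symbolParam P α (RiemannSphere.inv (t : OnePoint ℂ)) =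
      (ratio ((derivative P).reverse.eval t - α * P.reverse.eval t)
        (t * (derivative P).reverse.eval t),
      ratio (t * (derivative P).reverse.eval t) (α * P.reverse.eval t)) := by
  by_cases ht : t = 0
  · subst ht
    have h1 : (α : ℂ) * P.reverse.eval 0 ≠ 0 := by
      rw [eval_zero_reverse]
      exact mul_ne_zero h.alpha_ne_zero (leadingCoeff_ne_zero.2 h.ne_zero)
    rw [inv_coe_zero, symbolParam_infty, zero_mul, ratio_zero_right, ratio_of_ne_zero _ h1,
      zero_div]
  · have h2 : t ^ P.natDegree = t * t ^ (P.natDegree - 1) := by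
      rw [← pow_succ', Nat.sub_add_cancel (by have := h.two_le; omega)]
    have h3 : t ^ P.natDegree ≠ 0 := pow_ne_zero _ ht
    rw [inv_coe_of_ne_zero ht, symbolParam_coe, eval_reverse _ ht, eval_reverse _ ht,
      natDegree_derivative, ← ratio_mul_left h3, ← ratio_mul_left h3 (eval t⁻¹ (derivative P))]
    congr 2
    · rw [h2]
      field_simp
    · rw [h2]
      ring
    · rw [h2]
      ring
    · ring

/-- The homogeneous coordinates have no common zero: at `u = ∞` the first is `d - α` times the
leading coefficient of `P`, and at finite `u` a common zero would be a common root of `P` and `P'`.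
-/
theorem mdifferentiable_fst (h : IsGenericSymbol P α) :
    MDifferentiable 𝓘(ℂ) 𝓘(ℂ) fun p => (symbolParam P α p).1 := by
  intro p
  induction p using OnePoint.rec with
  | infty =>
    refine mdifferentiableAt_infty_of_comp ?_
    simp only [h.symbolParam_inv_coe]
    refine mdifferentiableAt_ratio ?_ ?_ (Or.inl ?_)
    · exact (Polynomial.differentiableAt _).sub ((Polynomial.differentiableAt _).const_mul _)
    · exact differentiableAt_id.mul (Polynomial.differentiableAt _)
    · rw [eval_zero_reverse, eval_zero_reverse, leadingCoeff_derivative,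
        mul_comm P.leadingCoeff, ← sub_mul]
      exact mul_ne_zero h.degree_ne_alpha (leadingCoeff_ne_zero.2 h.ne_zero)
  | coe u =>
    refine mdifferentiableAt_coe_of_comp ?_
    simp only [symbolParam_coe]
    refine mdifferentiableAt_ratio ?_ (Polynomial.differentiableAt _) ?_
    · exact (differentiableAt_id.mul (Polynomial.differentiableAt _)).sub
        ((Polynomial.differentiableAt _).const_mul _)
    · by_cases hu : (derivative P).eval u = 0
      · left
        rw [hu, mul_zero, zero_sub, neg_ne_zero]
        exact mul_ne_zero h.alpha_ne_zero (eval_ne_zero_of_isCoprime h.coprime.symm hu)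
      · exact Or.inr hu

theorem mdifferentiable_snd (h : IsGenericSymbol P α) :
    MDifferentiable 𝓘(ℂ) 𝓘(ℂ) fun p => (symbolParam P α p).2 := by
  intro p
  induction p using OnePoint.rec with
  | infty =>
    refine mdifferentiableAt_infty_of_comp ?_
    simp only [h.symbolParam_inv_coe]
    refine mdifferentiableAt_ratio ?_ ?_ (Or.inr ?_)
    · exact differentiableAt_id.mul (Polynomial.differentiableAt _)
    · exact (Polynomial.differentiableAt _).const_mul _
    · rw [eval_zero_reverse]
      exact mul_ne_zero h.alpha_ne_zero (leadingCoeff_ne_zero.2 h.ne_zero)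
  | coe u =>
    refine mdifferentiableAt_coe_of_comp ?_
    simp only [symbolParam_coe]
    refine mdifferentiableAt_ratio (Polynomial.differentiableAt _)
      ((Polynomial.differentiableAt _).const_mul _) ?_
    by_cases hu : (derivative P).eval u = 0
    · exact Or.inr (mul_ne_zero h.alpha_ne_zero (eval_ne_zero_of_isCoprime h.coprime.symm hu))
    · exact Or.inl hu

theorem continuous_symbolParam (h : IsGenericSymbol P α) : Continuous (symbolParam P α) :=
  h.mdifferentiable_fst.continuous.prodMk h.mdifferentiable_snd.continuous

/-! ### Values and fibres of the parametrisation. -/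

theorem symbolParam_coe_of_derivative_eq_zero (h : IsGenericSymbol P α) {u : ℂ}
    (hu : (derivative P).eval u = 0) :
    symbolParam P α (u : OnePoint ℂ) = (OnePoint.infty, ((0 : ℂ) : OnePoint ℂ)) := by
  have h1 := mul_ne_zero h.alpha_ne_zero (eval_ne_zero_of_isCoprime h.coprime.symm hu)
  rw [symbolParam_coe, ratio_of_ne_zero _ h1, hu, ratio_zero_right, zero_div]

theorem symbolParam_coe_of_eval_eq_zero (h : IsGenericSymbol P α) {u : ℂ} (hu : P.eval u = 0) :
    symbolParam P α (u : OnePoint ℂ) = ((u : OnePoint ℂ), OnePoint.infty) := by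
  have h1 := eval_ne_zero_of_isCoprime h.coprime hu
  rw [symbolParam_coe, ratio_of_ne_zero _ h1, hu, mul_zero, ratio_zero_right, sub_zero,
    mul_div_cancel_right₀ _ h1]

theorem symbolParam_coe_of_ne_zero (h : IsGenericSymbol P α) {u : ℂ} (hu : P.eval u ≠ 0)
    (hu' : (derivative P).eval u ≠ 0) :
    symbolParam P α (u : OnePoint ℂ) =
      (((u - α * P.eval u / (derivative P).eval u : ℂ) : OnePoint ℂ),
        (((derivative P).eval u / (α * P.eval u) : ℂ) : OnePoint ℂ)) := by
  rw [symbolParam_coe, ratio_of_ne_zero _ hu', ratio_of_ne_zero _ (mul_ne_zero h.alpha_ne_zero hu),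
    sub_div, mul_div_cancel_right₀ _ hu']

theorem symbolParam_fst_eq_infty_iff {p : OnePoint ℂ} :
    (symbolParam P α p).1 = OnePoint.infty ↔
      p = OnePoint.infty ∨ ∃ u : ℂ, (derivative P).eval u = 0 ∧ p = (u : OnePoint ℂ) := by
  induction p using OnePoint.rec with
  | infty => simp [symbolParam_infty]
  | coe u =>
    rw [symbolParam_coe, ratio_eq_infty]
    simp

theorem symbolParam_snd_eq_infty_iff (h : IsGenericSymbol P α) {p : OnePoint ℂ} :
    (symbolParam P α p).2 = OnePoint.infty ↔ ∃ u : ℂ, P.eval u = 0 ∧ p = (u : OnePoint ℂ) := by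
  induction p using OnePoint.rec with
  | infty => simp [symbolParam_infty]
  | coe u =>
    rw [symbolParam_coe, ratio_eq_infty]
    simpa using fun h0 => absurd h0 h.pos.ne'

theorem symbolParam_eq_infty_zero_iff (h : IsGenericSymbol P α) {p : OnePoint ℂ} :
    symbolParam P α p = (OnePoint.infty, ((0 : ℂ) : OnePoint ℂ)) ↔
      p = OnePoint.infty ∨ ∃ u : ℂ, (derivative P).eval u = 0 ∧ p = (u : OnePoint ℂ) := by
  rw [← symbolParam_fst_eq_infty_iff (P := P) (α := α)]
  refine ⟨fun h1 => by rw [h1], fun h1 => ?_⟩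
  rcases symbolParam_fst_eq_infty_iff.1 h1 with rfl | ⟨u, hu, rfl⟩
  · rfl
  · exact h.symbolParam_coe_of_derivative_eq_zero hu

theorem symbolParam_eq_coe_infty_iff (h : IsGenericSymbol P α) {p : OnePoint ℂ} {z : ℂ}
    (hz : P.eval z = 0) :
    symbolParam P α p = ((z : OnePoint ℂ), OnePoint.infty) ↔ p = (z : OnePoint ℂ) := by
  refine ⟨fun h1 => ?_, fun h1 => by rw [h1, h.symbolParam_coe_of_eval_eq_zero hz]⟩
  obtain ⟨u, hu, rfl⟩ := h.symbolParam_snd_eq_infty_iff.1 (congrArg Prod.snd h1)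
  rw [h.symbolParam_coe_of_eval_eq_zero hu] at h1
  exact congrArg Prod.fst h1

/-- The parameter is recovered as `u = z + 1/w`. Away from `(∞, 0)` one has `P'(u) ≠ 0`, so `z` and
`1/w` are both finite. -/
theorem symbolParam_injOn (h : IsGenericSymbol P α) {p q : OnePoint ℂ}
    (hp : symbolParam P α p ≠ (OnePoint.infty, ((0 : ℂ) : OnePoint ℂ)))
    (hpq : symbolParam P α p = symbolParam P α q) : p = q := by
  have hq := hpq ▸ hp
  induction p using OnePoint.rec with
  | infty => exact absurd rfl hp
  | coe u =>
    induction q using OnePoint.rec with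
    | infty => exact absurd rfl hq
    | coe v =>
      have hu : (derivative P).eval u ≠ 0 := fun h0 =>
        hp (h.symbolParam_coe_of_derivative_eq_zero h0)
      have hv : (derivative P).eval v ≠ 0 := fun h0 =>
        hq (h.symbolParam_coe_of_derivative_eq_zero h0)
      -- The second coordinates are compared through `1/w`, so that `w = ∞` is included.
      rw [symbolParam_coe, symbolParam_coe, Prod.mk.injEq, ratio_of_ne_zero _ hu,
        ratio_of_ne_zero _ hv, ratio_eq_inv hu, ratio_eq_inv hv, inv_involutive.injective.eq_iff,
        OnePoint.coe_eq_coe, OnePoint.coe_eq_coe, sub_div, sub_div, mul_div_cancel_right₀ _ hu,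
        mul_div_cancel_right₀ _ hv] at hpq
      rw [OnePoint.coe_eq_coe]
      linear_combination hpq.1 + hpq.2

theorem affine_eq_image (h : IsGenericSymbol P α) :
    {p : SphereSq | ∃ z w : ℂ, (scaledSymbol P α).evalEval z w = 0 ∧
        p = ((z : OnePoint ℂ), (w : OnePoint ℂ))} =
      symbolParam P α '' {p | ∃ u : ℂ, P.eval u ≠ 0 ∧ (derivative P).eval u ≠ 0 ∧
        p = (u : OnePoint ℂ)} := by
  ext p
  constructor
  · rintro ⟨z, w, hzw, rfl⟩
    have hw : w ≠ 0 := by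
      rintro rfl
      exact evalEval_scaledSymbol_zero_ne h.ne_zero h.lt z hzw
    rw [evalEval_scaledSymbol h.natDegree_ne_zero α z hw] at hzw
    have h1 := (mul_eq_zero.1 hzw).resolve_left (pow_ne_zero _ hw)
    set u := z + w⁻¹ with hu
    have hPu : P.eval u ≠ 0 := by
      intro h2
      rw [h2, mul_zero, zero_sub, neg_eq_zero] at h1
      exact eval_ne_zero_of_isCoprime h.coprime h2 h1
    have hα := h.alpha_ne_zero
    have h3 : (derivative P).eval u = α * w * P.eval u := by linear_combination -h1
    have hPu' : (derivative P).eval u ≠ 0 := by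
      rw [h3]
      exact mul_ne_zero (mul_ne_zero hα hw) hPu
    refine ⟨u, ⟨u, hPu, hPu', rfl⟩, ?_⟩
    rw [h.symbolParam_coe_of_ne_zero hPu hPu', h3]
    congr 2
    · have h4 : α * P.eval u / (α * w * P.eval u) = w⁻¹ := by field_simp
      rw [h4, hu]
      ring
    · field_simp
  · rintro ⟨_, ⟨u, hu, hu', rfl⟩, rfl⟩
    refine ⟨_, _, ?_, h.symbolParam_coe_of_ne_zero hu hu'⟩
    have hα := h.alpha_ne_zero
    rw [evalEval_scaledSymbol h.natDegree_ne_zero α _ (div_ne_zero hu' (mul_ne_zero hα hu)), inv_div,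
      sub_add_cancel]
    refine mul_eq_zero_of_right _ ?_
    field_simp
    ring

/-- The affine curve is the image of the sphere minus finitely many points. These parameters are
dense, so continuity puts the whole image in the closure; the image is compact, hence closed, which
gives the converse. -/
theorem range_symbolParam (h : IsGenericSymbol P α) :
    Set.range (symbolParam P α) = curveClosure (scaledSymbol P α) := by
  rw [curveClosure, h.affine_eq_image]
  apply Set.Subset.antisymm
  · have hdense : Dense {p : OnePoint ℂ | ∃ u : ℂ, P.eval u ≠ 0 ∧ (derivative P).eval u ≠ 0 ∧
        p = (u : OnePoint ℂ)} := by
      have hfin : (insert OnePoint.infty ((↑) '' ({u : ℂ | P.IsRoot u} ∪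
          {u : ℂ | (derivative P).IsRoot u})) : Set (OnePoint ℂ)).Finite :=
        (((finite_setOfPred_isRoot h.ne_zero).union
          (finite_setOfPred_isRoot h.derivative_ne_zero)).image _).insert _
      refine (dense_univ.sdiff_finite hfin).mono ?_
      rintro p ⟨-, hp⟩
      induction p using OnePoint.rec with
      | infty => exact absurd (Set.mem_insert _ _) hp
      | coe u =>
        refine ⟨u, fun h1 => hp (Or.inr ⟨u, Or.inl h1, rfl⟩),
          fun h1 => hp (Or.inr ⟨u, Or.inr h1, rfl⟩), rfl⟩
    rw [← Set.image_univ, ← hdense.closure_eq]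
    exact image_closure_subset_closure_image h.continuous_symbolParam
  · exact closure_minimal (Set.image_subset_range _ _)
      (isCompact_range h.continuous_symbolParam).isClosed

theorem finite_fibre (h : IsGenericSymbol P α) :
    {p | symbolParam P α p = (OnePoint.infty, ((0 : ℂ) : OnePoint ℂ))}.Finite := by
  refine (((finite_setOfPred_isRoot h.derivative_ne_zero).image
    ((↑) : ℂ → OnePoint ℂ)).insert OnePoint.infty).subset fun p hp => ?_
  rcases h.symbolParam_eq_infty_zero_iff.1 hp with rfl | ⟨u, hu, rfl⟩
  · exact Set.mem_insert _ _
  · exact Or.inr ⟨u, hu, rfl⟩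

theorem isNormalisation (h : IsGenericSymbol P α) :
    IsNormalisation (scaledSymbol P α) (symbolParam P α) where
  isManifold := inferInstance
  compact := inferInstance
  t2 := inferInstance
  connected := inferInstance
  holomorphic_fst := h.mdifferentiable_fst
  holomorphic_snd := h.mdifferentiable_snd
  range_eq := h.range_symbolParam
  finite_nonInjective := by
    refine h.finite_fibre.subset ?_
    rintro p ⟨q, hqp, hq⟩
    by_contra hp
    exact hqp (h.symbolParam_injOn hp hq.symm).symm

theorem existsUnique_preimage (h : IsGenericSymbol P α) {x : SphereSq}
    (hx : x ∈ curveClosure (scaledSymbol P α))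
    (hx' : x ≠ (OnePoint.infty, ((0 : ℂ) : OnePoint ℂ))) : ∃! p, symbolParam P α p = x := by
  rw [← h.range_symbolParam] at hx
  obtain ⟨p, rfl⟩ := hx
  exact ⟨p, rfl, fun q hq => (h.symbolParam_injOn hx' hq.symm).symm⟩

theorem fibre_infty (h : IsGenericSymbol P α) :
    {p ∈ curveClosure (scaledSymbol P α) | p.1 = OnePoint.infty} =
      {(OnePoint.infty, ((0 : ℂ) : OnePoint ℂ))} := by
  rw [← h.range_symbolParam]
  ext x
  constructor
  · rintro ⟨⟨p, rfl⟩, hp⟩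
    exact h.symbolParam_eq_infty_zero_iff.2 (symbolParam_fst_eq_infty_iff.1 hp)
  · rintro rfl
    exact ⟨⟨OnePoint.infty, rfl⟩, rfl⟩

theorem singularPoints_eq (h : IsGenericSymbol P α) :
    singularPoints (scaledSymbol P α) = {(OnePoint.infty, ((0 : ℂ) : OnePoint ℂ))} := by
  have hα : α ≠ 0 := h.pos.ne'
  ext x
  constructor
  · rintro ⟨hx, hx'⟩
    rw [← h.range_symbolParam] at hx
    obtain ⟨p, rfl⟩ := hx
    by_contra hp
    induction p using OnePoint.rec with
    | infty => exact hp rfl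
    | coe u =>
      have hu' : (derivative P).eval u ≠ 0 := fun h0 =>
        hp (h.symbolParam_coe_of_derivative_eq_zero h0)
      by_cases hu : P.eval u = 0
      · rw [h.symbolParam_coe_of_eval_eq_zero hu] at hx'
        refine fderiv_reverse_scaledSymbol_ne_zero h.ne_zero hα hu' ?_
        simpa [localEquation, coord_coe, coord_infty] using hx'
      · have hmem : symbolParam P α (u : OnePoint ℂ) ∈
            symbolParam P α '' {p | ∃ u : ℂ, P.eval u ≠ 0 ∧ (derivative P).eval u ≠ 0 ∧
              p = (u : OnePoint ℂ)} := ⟨u, ⟨u, hu, hu', rfl⟩, rfl⟩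
        rw [← h.affine_eq_image] at hmem
        obtain ⟨z, w, hzw, heq⟩ := hmem
        rw [heq] at hx'
        refine fderiv_scaledSymbol_ne_zero h.natDegree_ne_zero h.coprime hα h.lt hzw ?_
        simpa [localEquation, coord_coe] using hx'
  · rintro rfl
    refine ⟨?_, ?_⟩
    · rw [← h.range_symbolParam]
      exact ⟨OnePoint.infty, rfl⟩
    · exact (hasSlopePolynomial_scaledSymbol rfl (by have := h.two_le; omega) hα).fderiv_eq_zero
        h.two_le

end IsGenericSymbol

/-! ### The form `w dz` in the parameter `u` -/

/-- The coefficient of `w dz` in the parameter `u`: the logarithmic derivative of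
`P ^ ((1 - α) / α) * P'`. -/
noncomputable def symbolForm (P : ℂ[X]) (α : ℝ) (u : ℂ) : ℂ :=
  (1 - α) / α * ((derivative P).eval u / P.eval u) +
    (derivative (derivative P)).eval u / (derivative P).eval u

theorem eventually_nhdsNE_eval_ne_zero {Q : ℂ[X]} (hQ : Q ≠ 0) (a : ℂ) :
    ∀ᶠ t in 𝓝[≠] a, Q.eval t ≠ 0 :=
  nhdsNE_le_cofinite a (finite_setOfPred_isRoot hQ).eventually_cofinite_notMem

theorem Polynomial.analyticAt_eval (Q : ℂ[X]) (a : ℂ) : AnalyticAt ℂ (fun t => Q.eval t) a :=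
  Q.differentiable.analyticAt a

theorem exists_eval_eq_sub_mul {Q : ℂ[X]} {a : ℂ} (ha : Q.eval a = 0) :
    ∃ Q₁ : ℂ[X], (∀ t, Q.eval t = (t - a) * Q₁.eval t) ∧ Q₁.eval a = (derivative Q).eval a := by
  obtain ⟨Q₁, hQ₁⟩ := dvd_iff_isRoot.2 ha
  refine ⟨Q₁, fun t => ?_, ?_⟩
  · rw [hQ₁]
    simp
  · rw [hQ₁]
    simp

namespace IsGenericSymbol

open RiemannSphere

variable {P : ℂ[X]} {α : ℝ}

theorem hasDerivAt_fst {P : ℂ[X]} (α : ℝ) {u : ℂ} (hu : (derivative P).eval u ≠ 0) :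
    HasDerivAt (fun s => (s * (derivative P).eval s - α * P.eval s) / (derivative P).eval s)
      (1 - α + α * P.eval u * (derivative (derivative P)).eval u / (derivative P).eval u ^ 2) u := by
  have h1 : HasDerivAt (fun s => s * (derivative P).eval s - α * P.eval s)
      (1 * (derivative P).eval u + u * (derivative (derivative P)).eval u
        - α * (derivative P).eval u) u :=
    ((hasDerivAt_id u).mul ((derivative P).hasDerivAt u)).sub ((P.hasDerivAt u).const_mul (α : ℂ))
  have h2 := h1.div ((derivative P).hasDerivAt u) hu
  refine h2.congr_deriv ?_
  field_simp
  ring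

theorem snd_mul_deriv_fst (h : IsGenericSymbol P α) {u : ℂ} (hu : P.eval u ≠ 0)
    (hu' : (derivative P).eval u ≠ 0) :
    (derivative P).eval u / (α * P.eval u) *
      (1 - α + α * P.eval u * (derivative (derivative P)).eval u / (derivative P).eval u ^ 2)
      = symbolForm P α u := by
  have := h.alpha_ne_zero
  rw [symbolForm]
  field_simp

theorem formCoeff_coe (a t : ℂ) :
    formCoeff (symbolParam P α) (a : OnePoint ℂ) t = (derivative P).eval t / (α * P.eval t) *
      deriv (fun s => (s * (derivative P).eval s - α * P.eval s) / (derivative P).eval s) t := by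
  simp only [formCoeff, chartAt_coe, finiteChart_symm_apply, symbolParam_coe, coord_ratio]

theorem eventually_formCoeff_coe (h : IsGenericSymbol P α) (a : ℂ) :
    ∀ᶠ t in 𝓝[≠] a, formCoeff (symbolParam P α) (a : OnePoint ℂ) t = symbolForm P α t := by
  filter_upwards [eventually_nhdsNE_eval_ne_zero h.ne_zero a,
    eventually_nhdsNE_eval_ne_zero h.derivative_ne_zero a] with t ht ht'
  rw [formCoeff_coe, (hasDerivAt_fst α ht').deriv, h.snd_mul_deriv_fst ht ht']

theorem formCoeff_infty (h : IsGenericSymbol P α) {t : ℂ} (ht : t ≠ 0) (hP : P.eval t⁻¹ ≠ 0)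
    (hP' : (derivative P).eval t⁻¹ ≠ 0) :
    formCoeff (symbolParam P α) OnePoint.infty t = symbolForm P α t⁻¹ * -(t ^ 2)⁻¹ := by
  have h1 : HasDerivAt (fun s : ℂ => coord (symbolParam P α (RiemannSphere.inv (s : OnePoint ℂ))).1)
      ((1 - α + α * P.eval t⁻¹ * (derivative (derivative P)).eval t⁻¹ /
        (derivative P).eval t⁻¹ ^ 2) * -(t ^ 2)⁻¹) t := by
    refine ((hasDerivAt_fst α hP').comp t (hasDerivAt_inv ht)).congr_of_eventuallyEq ?_
    filter_upwards [isOpen_ne.mem_nhds ht] with s hs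
    rw [inv_coe_of_ne_zero hs, symbolParam_coe, coord_ratio]
    rfl
  simp only [formCoeff, chartAt_infty, inftyChart_symm_apply]
  rw [h1.deriv, inv_coe_of_ne_zero ht, symbolParam_coe, coord_ratio, ← mul_assoc,
    h.snd_mul_deriv_fst hP hP']

/-- For `α = 1` the term with `P'/P` has coefficient zero, so roots of `P` are harmless. -/
theorem analyticAt_symbolForm {a : ℂ} (ha' : (derivative P).eval a ≠ 0)
    (ha : P.eval a ≠ 0 ∨ α = 1) : AnalyticAt ℂ (symbolForm P α) a := by
  have h1 : AnalyticAt ℂ (fun u => (derivative (derivative P)).eval u / (derivative P).eval u) a :=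
    (analyticAt_eval _ a).div (analyticAt_eval _ a) ha'
  rcases ha with ha | ha
  · exact (analyticAt_const.mul ((analyticAt_eval _ a).div (analyticAt_eval _ a) ha)).add h1
  · refine h1.congr (Eventually.of_forall fun u => ?_)
    simp [symbolForm, ha]

/-- Near a root of `P`, the form is `g(t) / (t - a)` with `g(a) = (1 - α) / α`. -/
theorem exists_formCoeff_of_root (h : IsGenericSymbol P α) {a : ℂ} (ha : P.eval a = 0) :
    ∃ g : ℂ → ℂ, AnalyticAt ℂ g a ∧ g a = (1 - α) / α ∧
      ∀ᶠ t in 𝓝[≠] a, formCoeff (symbolParam P α) (a : OnePoint ℂ) t = g t / (t - a) := by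
  obtain ⟨Q, hQ, hQa⟩ := exists_eval_eq_sub_mul ha
  have ha' := eval_ne_zero_of_isCoprime h.coprime ha
  -- Multiply the form by `t - a`, using `P = (t - a) Q`; since `Q(a) = P'(a)`, the first quotient
  -- is `1` at `a`.
  refine ⟨fun t => (1 - α) / α * ((derivative P).eval t / Q.eval t) +
    (t - a) * ((derivative (derivative P)).eval t / (derivative P).eval t), ?_, ?_, ?_⟩
  · exact (analyticAt_const.mul ((analyticAt_eval _ a).div (analyticAt_eval _ a)
      (hQa ▸ ha'))).add ((analyticAt_id.sub analyticAt_const).mul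
        ((analyticAt_eval _ a).div (analyticAt_eval _ a) ha'))
  · simp only [hQa, div_self ha', sub_self, zero_mul, mul_one, add_zero]
  · filter_upwards [h.eventually_formCoeff_coe a, self_mem_nhdsWithin] with t ht hne
    have hta : t - a ≠ 0 := sub_ne_zero.2 hne
    rw [ht, symbolForm, hQ, add_div, mul_div_cancel_left₀ _ hta]
    congr 1
    rw [mul_div_assoc, div_div, mul_comm (Q.eval t)]

/-- Near a root of `P'`, the form is `g(t) / (t - a)` with `g(a) = 1`. -/
theorem exists_formCoeff_of_derivative_root (h : IsGenericSymbol P α) {a : ℂ}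
    (ha : (derivative P).eval a = 0) :
    ∃ g : ℂ → ℂ, AnalyticAt ℂ g a ∧ g a = 1 ∧
      ∀ᶠ t in 𝓝[≠] a, formCoeff (symbolParam P α) (a : OnePoint ℂ) t = g t / (t - a) := by
  obtain ⟨Q, hQ, hQa⟩ := exists_eval_eq_sub_mul ha
  have ha' := eval_ne_zero_of_isCoprime h.coprime' ha
  have haP := eval_ne_zero_of_isCoprime h.coprime.symm ha
  refine ⟨fun t => (t - a) * ((1 - α) / α * ((derivative P).eval t / P.eval t)) +
    (derivative (derivative P)).eval t / Q.eval t, ?_, ?_, ?_⟩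
  · exact ((analyticAt_id.sub analyticAt_const).mul (analyticAt_const.mul
      ((analyticAt_eval _ a).div (analyticAt_eval _ a) haP))).add
        ((analyticAt_eval _ a).div (analyticAt_eval _ a) (hQa ▸ ha'))
  · simp only [hQa, div_self ha', sub_self, zero_mul, zero_add]
  · filter_upwards [h.eventually_formCoeff_coe a, self_mem_nhdsWithin] with t ht hne
    have hta : t - a ≠ 0 := sub_ne_zero.2 hne
    rw [ht, symbolForm, add_div, mul_div_cancel_left₀ _ hta]
    congr 1
    rw [hQ, div_div, mul_comm (Q.eval t)]

/-- Near `∞`, the form is `g(t) / t` with `g(0) = (α - d) / α`. -/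
theorem exists_formCoeff_infty (h : IsGenericSymbol P α) :
    ∃ g : ℂ → ℂ, AnalyticAt ℂ g 0 ∧ g 0 = (α - P.natDegree) / α ∧
      ∀ᶠ t in 𝓝[≠] 0, formCoeff (symbolParam P α) OnePoint.infty t = g t / (t - 0) := by
  have hlead : P.leadingCoeff ≠ 0 := leadingCoeff_ne_zero.2 h.ne_zero
  have hn : (P.natDegree : ℂ) ≠ 0 := Nat.cast_ne_zero.2 h.natDegree_ne_zero
  have hQ0 : P.reverse.eval 0 ≠ 0 := by
    rwa [eval_zero_reverse]
  have hR0 : (derivative P).reverse.eval 0 ≠ 0 := by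
    rw [eval_zero_reverse, leadingCoeff_derivative]
    exact mul_ne_zero hlead hn
  have hα := h.alpha_ne_zero
  -- In `u = 1/t` each logarithmic derivative is `t` times a quotient of reversed polynomials, while
  -- `du = -t⁻² dt` supplies the sign and leaves `1/t`. At `t = 0` the two quotients are `d` and `d
  -- - 1`.
  refine ⟨fun t => -((1 - α) / α * ((derivative P).reverse.eval t / P.reverse.eval t) +
    (derivative (derivative P)).reverse.eval t / (derivative P).reverse.eval t), ?_, ?_, ?_⟩
  · exact ((analyticAt_const.mul ((analyticAt_eval _ 0).div (analyticAt_eval _ 0) hQ0)).add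
      ((analyticAt_eval _ 0).div (analyticAt_eval _ 0) hR0)).neg
  · have h2 := h.two_le
    simp only [eval_zero_reverse, leadingCoeff_derivative, natDegree_derivative,
      Nat.cast_sub (by omega : 1 ≤ P.natDegree)]
    push_cast
    field_simp
    ring
  · have hQ := (analyticAt_eval P.reverse 0).continuousAt.eventually_ne hQ0
    have hR := (analyticAt_eval (derivative P).reverse 0).continuousAt.eventually_ne hR0
    filter_upwards [hQ.filter_mono nhdsWithin_le_nhds, hR.filter_mono nhdsWithin_le_nhds,
      self_mem_nhdsWithin] with t hQt hRt hne
    have ht : t ≠ 0 := hne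
    rw [eval_reverse _ ht] at hQt hRt
    have h1 := right_ne_zero_of_mul hQt
    have h2 := right_ne_zero_of_mul hRt
    obtain ⟨n, hn⟩ : ∃ n, P.natDegree = n + 2 := ⟨P.natDegree - 2, by have := h.two_le; omega⟩
    rw [h.formCoeff_infty ht h1 h2, symbolForm, eval_reverse _ ht, eval_reverse _ ht,
      eval_reverse _ ht, natDegree_derivative (derivative P), natDegree_derivative, hn, sub_zero]
    simp only [show n + 2 - 1 = n + 1 from rfl, show n + 1 - 1 = n from rfl, pow_succ]
    field_simp

/-- The order of a function that is not meromorphic is `0` by default, so this is what gives the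
statements about `formOrder` their meaning. -/
theorem meromorphicAt_formCoeff (h : IsGenericSymbol P α) (p : OnePoint ℂ) :
    MeromorphicAt (formCoeff (symbolParam P α) p) (chartAt ℂ p p) := by
  induction p using OnePoint.rec with
  | infty =>
    obtain ⟨g, hg, -, hg'⟩ := h.exists_formCoeff_infty
    rw [chartAt_infty_apply_self]
    exact meromorphicAt_of_eq_div_sub hg hg'
  | coe a =>
    rw [chartAt_coe_apply_self]
    by_cases ha : P.eval a = 0
    · obtain ⟨g, hg, -, hg'⟩ := h.exists_formCoeff_of_root ha
      exact meromorphicAt_of_eq_div_sub hg hg'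
    · by_cases ha' : (derivative P).eval a = 0
      · obtain ⟨g, hg, -, hg'⟩ := h.exists_formCoeff_of_derivative_root ha'
        exact meromorphicAt_of_eq_div_sub hg hg'
      · exact (analyticAt_symbolForm ha' (Or.inl ha)).meromorphicAt.congr
          ((h.eventually_formCoeff_coe a).mono fun t ht => ht.symm)

/-! ### Orders and residues. -/

theorem formOrder_infty (h : IsGenericSymbol P α) :
    formOrder (symbolParam P α) OnePoint.infty = ((-1 : ℤ) : WithTop ℤ) := by
  obtain ⟨g, hg, hg0, hg'⟩ := h.exists_formCoeff_infty
  rw [formOrder, chartAt_infty_apply_self]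
  refine meromorphicOrderAt_of_eq_div_sub hg hg' ?_
  rw [hg0, ← neg_sub, neg_div, neg_ne_zero]
  exact div_ne_zero h.degree_ne_alpha h.alpha_ne_zero

theorem formOrder_of_derivative_root (h : IsGenericSymbol P α) {a : ℂ}
    (ha : (derivative P).eval a = 0) :
    formOrder (symbolParam P α) (a : OnePoint ℂ) = ((-1 : ℤ) : WithTop ℤ) := by
  obtain ⟨g, hg, hg0, hg'⟩ := h.exists_formCoeff_of_derivative_root ha
  rw [formOrder, chartAt_coe_apply_self]
  exact meromorphicOrderAt_of_eq_div_sub hg hg' (hg0 ▸ one_ne_zero)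

theorem formOrder_of_root (h : IsGenericSymbol P α) (hα : α ≠ 1) {a : ℂ} (ha : P.eval a = 0) :
    formOrder (symbolParam P α) (a : OnePoint ℂ) = ((-1 : ℤ) : WithTop ℤ) := by
  obtain ⟨g, hg, hg0, hg'⟩ := h.exists_formCoeff_of_root ha
  rw [formOrder, chartAt_coe_apply_self]
  refine meromorphicOrderAt_of_eq_div_sub hg hg' ?_
  rw [hg0]
  refine div_ne_zero (sub_ne_zero.2 ?_) h.alpha_ne_zero
  exact_mod_cast hα.symm

theorem formOrder_nonneg (h : IsGenericSymbol P α) {a : ℂ} (ha' : (derivative P).eval a ≠ 0)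
    (ha : P.eval a ≠ 0 ∨ α = 1) : 0 ≤ formOrder (symbolParam P α) (a : OnePoint ℂ) := by
  rw [formOrder, chartAt_coe_apply_self, meromorphicOrderAt_congr (h.eventually_formCoeff_coe a)]
  exact (analyticAt_symbolForm ha' ha).meromorphicOrderAt_nonneg

/-- The regular alternative is phrased in the parameter, since the periods need to know that a path
avoiding poles stays in `ℂ` and away from the zeros inside the logarithms. -/
theorem formOrder_cases (h : IsGenericSymbol P α) (p : OnePoint ℂ) :
    (formOrder (symbolParam P α) p = ((-1 : ℤ) : WithTop ℤ) ∧
      (symbolParam P α p = (OnePoint.infty, ((0 : ℂ) : OnePoint ℂ)) ∨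
        (α ≠ 1 ∧ ∃ z : ℂ, P.IsRoot z ∧ symbolParam P α p = ((z : OnePoint ℂ), OnePoint.infty)))) ∨
    (0 ≤ formOrder (symbolParam P α) p ∧ ∃ a : ℂ, p = (a : OnePoint ℂ) ∧
      (derivative P).eval a ≠ 0 ∧ (P.eval a ≠ 0 ∨ α = 1)) := by
  induction p using OnePoint.rec with
  | infty => exact Or.inl ⟨h.formOrder_infty, Or.inl rfl⟩
  | coe a =>
    by_cases ha' : (derivative P).eval a = 0
    · exact Or.inl ⟨h.formOrder_of_derivative_root ha',
        Or.inl (h.symbolParam_coe_of_derivative_eq_zero ha')⟩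
    by_cases ha : P.eval a ≠ 0 ∨ α = 1
    · exact Or.inr ⟨h.formOrder_nonneg ha' ha, a, rfl, ha', ha⟩
    · push Not at ha
      exact Or.inl ⟨h.formOrder_of_root ha.2 ha.1,
        Or.inr ⟨ha.2, a, ha.1, h.symbolParam_coe_of_eval_eq_zero ha.1⟩⟩

theorem formOrder_neg_iff (h : IsGenericSymbol P α) (p : OnePoint ℂ) :
    formOrder (symbolParam P α) p < 0 ↔
      symbolParam P α p = (OnePoint.infty, ((0 : ℂ) : OnePoint ℂ)) ∨
        (α ≠ 1 ∧ ∃ z : ℂ, P.IsRoot z ∧ symbolParam P α p = ((z : OnePoint ℂ), OnePoint.infty)) := by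
  rcases h.formOrder_cases p with ⟨h1, h2⟩ | ⟨h1, a, rfl, ha', ha⟩
  · refine ⟨fun _ => h2, fun _ => ?_⟩
    rw [h1]
    exact_mod_cast (by norm_num : (-1 : ℤ) < 0)
  · refine ⟨fun h2 => absurd h1 (not_le.2 h2), ?_⟩
    rintro (h2 | ⟨hα, z, hz, h2⟩)
    · have := symbolParam_fst_eq_infty_iff.1 (congrArg Prod.fst h2)
      simp [ha'] at this
    · rw [h.symbolParam_eq_coe_infty_iff hz, OnePoint.coe_eq_coe] at h2
      subst h2
      exact absurd hz (ha.resolve_right hα)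

theorem formOrder_eq_of_neg (h : IsGenericSymbol P α) {p : OnePoint ℂ}
    (hp : formOrder (symbolParam P α) p < 0) :
    formOrder (symbolParam P α) p = ((-1 : ℤ) : WithTop ℤ) := by
  rcases h.formOrder_cases p with ⟨h1, -⟩ | ⟨h1, -⟩
  · exact h1
  · exact absurd h1 (not_le.2 hp)

theorem hasFormResidue_infty (h : IsGenericSymbol P α) :
    HasFormResidue (symbolParam P α) OnePoint.infty ((α - P.natDegree) / α) := by
  obtain ⟨g, hg, hg0, hg'⟩ := h.exists_formCoeff_infty
  rw [HasFormResidue, chartAt_infty_apply_self, ← hg0]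
  exact eventually_circleIntegral_div_sub_eq hg hg'

theorem hasFormResidue_of_derivative_root (h : IsGenericSymbol P α) {a : ℂ}
    (ha : (derivative P).eval a = 0) :
    HasFormResidue (symbolParam P α) (a : OnePoint ℂ) 1 := by
  obtain ⟨g, hg, hg0, hg'⟩ := h.exists_formCoeff_of_derivative_root ha
  rw [HasFormResidue, chartAt_coe_apply_self, ← hg0]
  exact eventually_circleIntegral_div_sub_eq hg hg'

theorem hasFormResidue_of_root (h : IsGenericSymbol P α) {a : ℂ} (ha : P.eval a = 0) :
    HasFormResidue (symbolParam P α) (a : OnePoint ℂ) ((1 - α) / α) := by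
  obtain ⟨g, hg, hg0, hform⟩ := h.exists_formCoeff_of_root ha
  rw [HasFormResidue, chartAt_coe_apply_self, ← hg0]
  exact eventually_circleIntegral_div_sub_eq hg hform

/-! ### The branches at `(∞, 0)` -/

/-- Here `y = 1/z = P'/(u P' - α P)` has a simple zero because `P''(a) ≠ 0`, and `w/y = (u P' - α
P)/(α P)` is `-1` at `a`. -/
theorem isSmoothBranchAtInfty_of_derivative_root (h : IsGenericSymbol P α) {a : ℂ}
    (ha : (derivative P).eval a = 0) :
    IsSmoothBranchAtInfty (symbolParam P α) (a : OnePoint ℂ) (-1) := by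
  have haP := eval_ne_zero_of_isCoprime h.coprime.symm ha
  have ha' := eval_ne_zero_of_isCoprime h.coprime' ha
  have hα := h.alpha_ne_zero
  have hαP := mul_ne_zero hα haP
  have hN : AnalyticAt ℂ (fun t => t * (derivative P).eval t - α * P.eval t) a :=
    (analyticAt_id.mul (analyticAt_eval _ a)).sub (analyticAt_const.mul (analyticAt_eval _ a))
  have hNa : a * (derivative P).eval a - α * P.eval a ≠ 0 := by
    rw [ha, mul_zero, zero_sub]
    exact neg_ne_zero.2 hαP
  have hD : AnalyticAt ℂ (fun t => α * P.eval t) a := analyticAt_const.mul (analyticAt_eval _ a)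
  have hy : AnalyticAt ℂ (fun t => (derivative P).eval t /
      (t * (derivative P).eval t - α * P.eval t)) a := (analyticAt_eval _ a).div hN hNa
  have hk : (a * (derivative P).eval a - α * P.eval a) / (α * P.eval a) = -1 := by
    simp only [ha, mul_zero, zero_sub, neg_div, div_self hαP]
  rw [← hk]
  refine isSmoothBranchAtInfty_of_parametrisation
    (k := fun t => (t * (derivative P).eval t - α * P.eval t) / (α * P.eval t))
    (OnePoint.nhds_coe_eq a).symm hy ?_ ?_
    (hN.div hD hαP) ?_
  · simp only [ha, zero_div]
  · have h1 := ((derivative P).hasDerivAt a).div hN.differentiableAt.hasDerivAt hNa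
    have h2 := h1.deriv
    rw [ha, zero_mul, sub_zero] at h2
    refine ne_of_eq_of_ne h2 (div_ne_zero (mul_ne_zero ha' ?_) (pow_ne_zero _ ?_))
    · simpa [ha] using hNa
    · simpa [ha] using hNa
  · filter_upwards [hN.continuousAt.eventually_ne hNa, hD.continuousAt.eventually_ne hαP]
      with t ht ht'
    rw [symbolParam_coe, ratio_eq_inv ht, ratio_of_ne_zero _ ht', div_mul_div_cancel₀ ht]

/-- With `R`, `Q` the reverses of `P'`, `P`, one has `y = t R/(R - α Q)` and `w/y = (R - α Q)/(α
Q)`. Both claims follow from `R(0) = d Q(0) ≠ 0` and `α ≠ d`. -/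
theorem isSmoothBranchAtInfty_infty (h : IsGenericSymbol P α) :
    IsSmoothBranchAtInfty (symbolParam P α) OnePoint.infty ((P.natDegree : ℂ) / α - 1) := by
  have hlead : P.leadingCoeff ≠ 0 := leadingCoeff_ne_zero.2 h.ne_zero
  have hn : (P.natDegree : ℂ) ≠ 0 := Nat.cast_ne_zero.2 h.natDegree_ne_zero
  have hα := h.alpha_ne_zero
  have hR0 : (derivative P).reverse.eval 0 = P.leadingCoeff * P.natDegree := by
    rw [eval_zero_reverse, leadingCoeff_derivative]
  have hQ0 : P.reverse.eval 0 = P.leadingCoeff := eval_zero_reverse P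
  have hN : AnalyticAt ℂ (fun t => (derivative P).reverse.eval t - α * P.reverse.eval t) 0 :=
    (analyticAt_eval _ 0).sub (analyticAt_const.mul (analyticAt_eval _ 0))
  have hNa : (derivative P).reverse.eval 0 - α * P.reverse.eval 0 ≠ 0 := by
    rw [hR0, hQ0, mul_comm, ← sub_mul]
    exact mul_ne_zero h.degree_ne_alpha hlead
  have hD : AnalyticAt ℂ (fun t => α * P.reverse.eval t) 0 :=
    analyticAt_const.mul (analyticAt_eval _ 0)
  have hDa : α * P.reverse.eval 0 ≠ 0 := hQ0 ▸ mul_ne_zero hα hlead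
  have hT : HasDerivAt (fun t => t * (derivative P).reverse.eval t)
      ((derivative P).reverse.eval 0) 0 := by
    have := (hasDerivAt_id (0 : ℂ)).mul ((derivative P).reverse.hasDerivAt 0)
    simp only [id, one_mul, zero_mul, add_zero] at this
    exact this
  have hy : AnalyticAt ℂ (fun t => t * (derivative P).reverse.eval t /
      ((derivative P).reverse.eval t - α * P.reverse.eval t)) 0 :=
    (analyticAt_id.mul (analyticAt_eval _ 0)).div hN hNa
  have hk : ((derivative P).reverse.eval 0 - α * P.reverse.eval 0) /
      (α * P.reverse.eval 0) = (P.natDegree : ℂ) / α - 1 := by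
    simp only [hR0, hQ0]
    field_simp
  rw [← hk]
  refine isSmoothBranchAtInfty_of_parametrisation
    (k := fun t => ((derivative P).reverse.eval t - α * P.reverse.eval t) /
      (α * P.reverse.eval t)) nhds_infty_eq_map.symm hy ?_ ?_
    (hN.div hD hDa) ?_
  · simp only [zero_mul, zero_div]
  · have h1 := hT.div hN.differentiableAt.hasDerivAt hNa
    have h2 := h1.deriv
    rw [zero_mul, zero_mul, sub_zero] at h2
    exact ne_of_eq_of_ne h2 (div_ne_zero (mul_ne_zero (hR0 ▸ mul_ne_zero hlead hn) hNa)
      (pow_ne_zero _ hNa))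
  · filter_upwards [hN.continuousAt.eventually_ne hNa, hD.continuousAt.eventually_ne hDa]
      with t ht ht'
    rw [h.symbolParam_inv_coe, ratio_eq_inv ht, ratio_of_ne_zero _ ht', div_mul_div_cancel₀ ht]

end IsGenericSymbol

/-! ### Periods -/

/-- No logarithm along the path is needed: `f s / f t` is close to `1`, where the principal branch
is differentiable, and its real part is `log ‖f s‖ - log ‖f t‖`. -/
theorem hasDerivAt_log_norm {f : ℝ → ℂ} {f' : ℂ} {t : ℝ} (hf : HasDerivAt f f' t) (h : f t ≠ 0) :
    HasDerivAt (fun s => Real.log ‖f s‖) (f' / f t).re t := by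
  have h1 : HasDerivAt (fun s => f s / f t) (f' / f t) t := hf.div_const _
  have h2 : f t / f t ∈ Complex.slitPlane := by
    rw [div_self h]
    exact Complex.one_mem_slitPlane
  have h3 := h1.clog_real h2
  rw [div_self h, div_one] at h3
  have h4 : HasDerivAt (fun s => (Complex.log (f s / f t)).re + Real.log ‖f t‖) (f' / f t).re t :=
    (Complex.reCLM.hasFDerivAt.comp_hasDerivAt t h3).add_const _
  refine h4.congr_of_eventuallyEq ?_
  filter_upwards [hf.continuousAt.eventually_ne h] with s hs
  rw [Complex.log_re, norm_div, Real.log_div (norm_ne_zero_iff.2 hs) (norm_ne_zero_iff.2 h),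
    sub_add_cancel]

/-- The alternative `c = 0` serves the case `α = 1`, in which the path may pass through roots of
`P`. -/
theorem hasDerivAt_mul_log_norm {f : ℝ → ℂ} {f' : ℂ} {t c : ℝ} (hf : HasDerivAt f f' t)
    (h : f t ≠ 0 ∨ c = 0) :
    HasDerivAt (fun s => c * Real.log ‖f s‖) (c * (f' / f t).re) t := by
  rcases h with h | rfl
  · exact (hasDerivAt_log_norm hf h).const_mul c
  · simpa using hasDerivAt_const t (0 : ℝ)

theorem continuousOn_mul_log_norm {f : ℝ → ℂ} {s : Set ℝ} {c : ℝ} (hf : ContinuousOn f s)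
    (h : ∀ t ∈ s, f t ≠ 0 ∨ c = 0) : ContinuousOn (fun t => c * Real.log ‖f t‖) s := by
  by_cases hc : c = 0
  · simpa [hc] using continuousOn_const
  · exact continuousOn_const.mul
      (hf.norm.log fun t ht => norm_ne_zero_iff.2 ((h t ht).resolve_right hc))

namespace RiemannSphere

theorem extChartAt_coe_apply (z : ℂ) (x : OnePoint ℂ) :
    extChartAt 𝓘(ℝ, ℂ) (z : OnePoint ℂ) x = finiteChart x := by
  rw [extChartAt_coe, modelWithCornersSelf_coe, Function.id_comp, chartAt_coe]

/-- All finite points share one preferred chart, so a path avoiding `∞` is a single complex-valued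
function there. -/
theorem contDiffOn_finiteChart_comp {γ : ℝ → OnePoint ℂ} {s : Set ℝ}
    (hγ : ContMDiffOn 𝓘(ℝ, ℝ) 𝓘(ℝ, ℂ) 1 γ s) (h : ∀ t ∈ s, ∃ a : ℂ, γ t = a) :
    ContDiffOn ℝ 1 (fun t => finiteChart (γ t)) s := by
  intro t ht
  have h1 := (contMDiffWithinAt_iff.1 (hγ t ht)).2
  obtain ⟨a, ha⟩ := h t ht
  rw [ha] at h1
  have h2 : (extChartAt 𝓘(ℝ, ℂ) (a : OnePoint ℂ) : OnePoint ℂ → ℂ) = finiteChart :=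
    funext (extChartAt_coe_apply a)
  rw [h2] at h1
  have h3 : ContDiffWithinAt ℝ 1 (fun t => finiteChart (γ t)) (id ⁻¹' s ∩ Set.range id) t := h1
  simpa using h3

theorem mfderivWithin_apply_one {γ : ℝ → OnePoint ℂ} {s : Set ℝ}
    (hγ : ContMDiffOn 𝓘(ℝ, ℝ) 𝓘(ℝ, ℂ) 1 γ s) {t : ℝ} (ht : t ∈ s) {a : ℂ} (ha : γ t = a) :
    (show ℂ from mfderivWithin 𝓘(ℝ, ℝ) 𝓘(ℝ, ℂ) γ s t (1 : ℝ))
      = derivWithin (fun t => finiteChart (γ t)) s t := by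
  have h1 : MDifferentiableWithinAt 𝓘(ℝ, ℝ) 𝓘(ℝ, ℂ) γ s t :=
    (hγ t ht).mdifferentiableWithinAt one_ne_zero
  have h2 : (extChartAt 𝓘(ℝ, ℂ) (γ t) : OnePoint ℂ → ℂ) = finiteChart := by
    rw [ha]
    exact funext (extChartAt_coe_apply a)
  have h3 : writtenInExtChartAt 𝓘(ℝ, ℝ) 𝓘(ℝ, ℂ) t γ = fun t => finiteChart (γ t) := by
    rw [writtenInExtChartAt, h2]
    rfl
  have h4 : mfderivWithin 𝓘(ℝ, ℝ) 𝓘(ℝ, ℂ) γ s t =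
      fderivWithin ℝ (writtenInExtChartAt 𝓘(ℝ, ℝ) 𝓘(ℝ, ℂ) t γ) (id ⁻¹' s ∩ Set.range id) t :=
    if_pos h1
  rw [h3, Set.preimage_id, Set.range_id, Set.inter_univ] at h4
  exact DFunLike.congr_fun h4 (1 : ℝ)

end RiemannSphere

theorem ncard_setOf_eval_eq_zero {Q : ℂ[X]} (hQ : Q ≠ 0) (h : Q.roots.Nodup) :
    {u : ℂ | Q.eval u = 0}.ncard = Q.natDegree := by
  have h1 : {u : ℂ | Q.eval u = 0} = (Q.roots.toFinset : Set ℂ) := by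
    ext u
    simp [hQ]
  rw [h1, Set.ncard_coe_finset, Multiset.toFinset_card_of_nodup h,
    splits_iff_card_roots.1 (IsAlgClosed.splits Q)]

namespace IsGenericSymbol

open RiemannSphere

variable {P : ℂ[X]} {α : ℝ}

theorem formValue_coe (h : IsGenericSymbol P α) {a : ℂ} (ha' : (derivative P).eval a ≠ 0)
    (ha : P.eval a ≠ 0 ∨ α = 1) :
    formValue (symbolParam P α) (a : OnePoint ℂ) = symbolForm P α a := by
  rw [formValue, chartAt_coe_apply_self]
  refine Tendsto.limUnder_eq ?_
  have h1 : Tendsto (symbolForm P α) (𝓝[≠] a) (𝓝 (symbolForm P α a)) :=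
    (analyticAt_symbolForm ha' ha).continuousAt.tendsto.mono_left nhdsWithin_le_nhds
  exact h1.congr' ((h.eventually_formCoeff_coe a).mono fun t ht => ht.symm)

/-- The real part of the integrand is the derivative of `c log|P| + log|P'|` along the path, with `c
= (1-α)/α` real. This function takes equal values at the two ends of a loop. -/
theorem hasImaginaryPeriods (h : IsGenericSymbol P α) : HasImaginaryPeriods (symbolParam P α) := by
  intro γ hγ hclosed hpole
  -- The point `∞` is always a pole, as `α ≠ d`; hence the loop lies in the finite chart.
  have hfin : ∀ t ∈ Set.Icc (0 : ℝ) 1, ∃ a : ℂ, γ t = (a : OnePoint ℂ) ∧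
      (derivative P).eval a ≠ 0 ∧ (P.eval a ≠ 0 ∨ α = 1) := by
    intro t ht
    rcases h.formOrder_cases (γ t) with ⟨h1, -⟩ | ⟨-, h1⟩
    · have h2 := hpole t ht
      rw [h1] at h2
      exact absurd h2 (by exact_mod_cast (by norm_num : ¬ (0 : ℤ) ≤ -1))
    · exact h1
  set g : ℝ → ℂ := fun t => finiteChart (γ t) with hg
  have hγg : ∀ t ∈ Set.Icc (0 : ℝ) 1, γ t = (g t : OnePoint ℂ) := by
    intro t ht
    obtain ⟨a, ha, -⟩ := hfin t ht
    rw [hg, ha]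
    simp only [ha, finiteChart_coe]
  have hreg : ∀ t ∈ Set.Icc (0 : ℝ) 1,
      (derivative P).eval (g t) ≠ 0 ∧ (P.eval (g t) ≠ 0 ∨ α = 1) := by
    intro t ht
    obtain ⟨a, ha, h1⟩ := hfin t ht
    rw [hγg t ht, OnePoint.coe_eq_coe] at ha
    rwa [ha]
  have hgC : ContDiffOn ℝ 1 g (Set.Icc 0 1) :=
    contDiffOn_finiteChart_comp hγ fun t ht => ⟨g t, hγg t ht⟩
  set g' : ℝ → ℂ := derivWithin g (Set.Icc 0 1) with hg'
  have hg'C : ContinuousOn g' (Set.Icc 0 1) :=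
    hgC.continuousOn_derivWithin (uniqueDiffOn_Icc zero_lt_one) le_rfl
  have hform : formIntegral (symbolParam P α) γ = ∫ t in (0 : ℝ)..1, symbolForm P α (g t) * g' t := by
    refine intervalIntegral.integral_congr fun t ht => ?_
    rw [Set.uIcc_of_le zero_le_one] at ht
    rw [mfderivWithin_apply_one hγ ht (hγg t ht), hγg t ht,
      h.formValue_coe (hreg t ht).1 (hreg t ht).2]
  have hcont : ContinuousOn (fun t => symbolForm P α (g t) * g' t) (Set.Icc 0 1) := by
    refine ContinuousOn.mul (fun t ht => ?_) hg'C
    exact (analyticAt_symbolForm (hreg t ht).1 (hreg t ht).2).continuousAt.comp_continuousWithinAt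
      (hgC.continuousOn t ht)
  have hII : IntervalIntegrable (fun t => symbolForm P α (g t) * g' t) MeasureTheory.volume 0 1 :=
    ContinuousOn.intervalIntegrable (by rwa [Set.uIcc_of_le zero_le_one])
  have hre : (∫ t in (0 : ℝ)..1, symbolForm P α (g t) * g' t).re
      = ∫ t in (0 : ℝ)..1, (symbolForm P α (g t) * g' t).re :=
    (Complex.reCLM.intervalIntegral_comp_comm hII).symm
  set c : ℝ := (1 - α) / α with hc
  have hc0 : α = 1 → c = 0 := fun h1 => by rw [hc, h1, sub_self, zero_div]
  -- This form of the fundamental theorem asks for derivatives only inside the interval, where the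
  -- one-sided derivative `g'` is a true derivative.
  have hftc := intervalIntegral.integral_eq_sub_of_hasDerivAt_of_le (a := 0) (b := 1)
    (f := fun t => c * Real.log ‖P.eval (g t)‖ + 1 * Real.log ‖(derivative P).eval (g t)‖)
    (f' := fun t => (symbolForm P α (g t) * g' t).re) zero_le_one ?_ ?_ ?_
  · rw [hform, hre, hftc]
    have h01 : g 0 = g 1 := by rw [hg]; simp only [hclosed]
    rw [h01, sub_self]
  · refine (continuousOn_mul_log_norm (P.continuous.comp_continuousOn hgC.continuousOn)
      fun t ht => (hreg t ht).2.imp_right hc0).add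
      (continuousOn_mul_log_norm ((derivative P).continuous.comp_continuousOn hgC.continuousOn)
        fun t ht => Or.inl (hreg t ht).1)
  · intro t ht
    have htI : t ∈ Set.Icc (0 : ℝ) 1 := Set.Ioo_subset_Icc_self ht
    have hder : HasDerivAt g (g' t) t :=
      ((hgC.differentiableOn one_ne_zero) t htI).hasDerivWithinAt.hasDerivAt
        (Icc_mem_nhds ht.1 ht.2)
    have h1 : HasDerivAt (fun s => P.eval (g s)) ((derivative P).eval (g t) * g' t) t :=
      (P.hasDerivAt (g t)).comp t hder
    have h2 : HasDerivAt (fun s => (derivative P).eval (g s))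
        ((derivative (derivative P)).eval (g t) * g' t) t :=
      ((derivative P).hasDerivAt (g t)).comp t hder
    refine ((hasDerivAt_mul_log_norm h1 ((hreg t htI).2.imp_right hc0)).add
      (hasDerivAt_mul_log_norm (c := 1) h2 (Or.inl (hreg t htI).1))).congr_deriv ?_
    have hcC : ((1 : ℂ) - α) / α = (c : ℂ) := by rw [hc]; push_cast; rfl
    rw [symbolForm, hcC, one_mul, ← Complex.re_ofReal_mul, ← Complex.add_re]
    congr 1
    ring
  · refine ContinuousOn.intervalIntegrable ?_
    rw [Set.uIcc_of_le zero_le_one]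
    exact Complex.continuous_re.comp_continuousOn hcont

theorem isAffineBoutroux (h : IsGenericSymbol P α) : IsAffineBoutroux (scaledSymbol P α) :=
  ⟨irreducible_scaledSymbol h.natDegree_ne_zero h.coprime h.pos.ne' h.lt, _, _, _,
    symbolParam P α, h.isNormalisation, h.hasImaginaryPeriods⟩

/-! ### Counting points -/

theorem ncard_fibre_infty (h : IsGenericSymbol P α) (hP' : (derivative P).roots.Nodup) :
    {p | symbolParam P α p = (OnePoint.infty, ((0 : ℂ) : OnePoint ℂ))}.ncard = P.natDegree := by
  have h1 : {p | symbolParam P α p = (OnePoint.infty, ((0 : ℂ) : OnePoint ℂ))} =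
      insert OnePoint.infty ((↑) '' {u : ℂ | (derivative P).eval u = 0}) := by
    ext p
    rw [Set.mem_ofPred_eq, h.symbolParam_eq_infty_zero_iff, Set.mem_insert_iff, Set.mem_image]
    simp only [Set.mem_ofPred_eq, eq_comm (a := p)]
  have h2 : {u : ℂ | (derivative P).eval u = 0}.Finite :=
    finite_setOfPred_isRoot h.derivative_ne_zero
  rw [h1, Set.ncard_insert_of_notMem (by simp) (h2.image _),
    Set.ncard_image_of_injective _ OnePoint.coe_injective,
    ncard_setOf_eval_eq_zero h.derivative_ne_zero hP', natDegree_derivative]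
  have := h.two_le
  omega

theorem ncard_poles_over_roots (h : IsGenericSymbol P α) (hP : P.roots.Nodup) :
    {p | ∃ z : ℂ, P.IsRoot z ∧
      symbolParam P α p = ((z : OnePoint ℂ), OnePoint.infty)}.ncard = P.natDegree := by
  have h1 : {p | ∃ z : ℂ, P.IsRoot z ∧ symbolParam P α p = ((z : OnePoint ℂ), OnePoint.infty)} =
      (↑) '' {u : ℂ | P.eval u = 0} := by
    ext p
    constructor
    · rintro ⟨z, hz, hp⟩
      exact ⟨z, hz, ((h.symbolParam_eq_coe_infty_iff hz).1 hp).symm⟩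
    · rintro ⟨z, hz, rfl⟩
      exact ⟨z, hz, h.symbolParam_coe_of_eval_eq_zero hz⟩
  rw [h1, Set.ncard_image_of_injective _ OnePoint.coe_injective,
    ncard_setOf_eval_eq_zero h.ne_zero hP]

end IsGenericSymbol

/-! ### The theorem. -/

theorem mainTheorem4 (P : ℂ[X]) (d : ℕ) (α : ℝ) (hdeg : P.natDegree = d) (hd : 2 ≤ d)
    (hP : StronglyGeneric P) (hα₀ : 0 < α) (hα₁ : α < d) :
    -- the curve is an affine Boutroux curve, irreducible and rational
    IsAffineBoutroux (scaledSymbol P α) ∧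
    Irreducible (scaledSymbol P α) ∧
    IsRationalCurve (scaledSymbol P α) ∧
    -- the fibre of the closure over `z = ∞`
    {p ∈ curveClosure (scaledSymbol P α) | p.1 = OnePoint.infty} =
      {(OnePoint.infty, ((0 : ℂ) : OnePoint ℂ))} ∧
    -- the equation of the slopes at `(∞, 0)` and its solutions with multiplicities
    (∃ c : ℂ, c ≠ 0 ∧
      HasSlopePolynomial
        (localEquation (scaledSymbol P α) (OnePoint.infty, ((0 : ℂ) : OnePoint ℂ))) d
        (C c * ((X + 1) ^ (d - 1) * (C (α : ℂ) * (X + 1) - C (d : ℂ))))) ∧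
    ((X + 1) ^ (d - 1) * (C (α : ℂ) * (X + 1) - C (d : ℂ)) : ℂ[X]).roots =
      ((d : ℂ) / α - 1) ::ₘ Multiset.replicate (d - 1) (-1) ∧
    (d : ℂ) / α - 1 ≠ -1 ∧
    -- the only singular point
    singularPoints (scaledSymbol P α) = {(OnePoint.infty, ((0 : ℂ) : OnePoint ℂ))} ∧
    -- the normalisation is the Riemann sphere
    ∃ ν : OnePoint ℂ → SphereSq,
      IsNormalisation (scaledSymbol P α) ν ∧
      HasImaginaryPeriods ν ∧
      (∀ x ∈ curveClosure (scaledSymbol P α),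
        x ≠ (OnePoint.infty, ((0 : ℂ) : OnePoint ℂ)) → ∃! p, ν p = x) ∧
      {p | ν p = (OnePoint.infty, ((0 : ℂ) : OnePoint ℂ))}.ncard = d ∧
      -- the poles of `w dz` are the points over `(∞, 0)` and, unless `α = 1`, the points over
      -- `(zᵢ, ∞)` with `zᵢ` a root of `P`; all of them are simple
      (∀ p, MeromorphicAt (formCoeff ν p) (chartAt ℂ p p)) ∧
      (∀ p, formOrder ν p < 0 ↔
        ν p = (OnePoint.infty, ((0 : ℂ) : OnePoint ℂ)) ∨
          (α ≠ 1 ∧ ∃ z : ℂ, P.IsRoot z ∧ ν p = ((z : OnePoint ℂ), OnePoint.infty))) ∧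
      (∀ p, formOrder ν p < 0 → formOrder ν p = ((-1 : ℤ) : WithTop ℤ)) ∧
      -- the `d` points over the roots of `P`
      {p | ∃ z : ℂ, P.IsRoot z ∧ ν p = ((z : OnePoint ℂ), OnePoint.infty)}.ncard = d ∧
      (∀ z : ℂ, P.IsRoot z → ∃! p, ν p = ((z : OnePoint ℂ), OnePoint.infty)) ∧
      (∀ z : ℂ, P.IsRoot z → ∀ p, ν p = ((z : OnePoint ℂ), OnePoint.infty) →
        HasFormResidue ν p ((1 - α) / α)) ∧
      -- the `d` branches at `(∞, 0)`
      ∃ p₀, ν p₀ = (OnePoint.infty, ((0 : ℂ) : OnePoint ℂ)) ∧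
        IsSmoothBranchAtInfty ν p₀ ((d : ℂ) / α - 1) ∧
        HasFormResidue ν p₀ ((α - d) / α) ∧
        ∀ p, ν p = (OnePoint.infty, ((0 : ℂ) : OnePoint ℂ)) → p ≠ p₀ →
          IsSmoothBranchAtInfty ν p (-1) ∧ HasFormResidue ν p 1 := by

  subst hdeg
  obtain ⟨hroots, hroots'⟩ := hP
  have hP0 : P ≠ 0 := by
    rintro rfl
    simp at hd
  have hP'0 : derivative P ≠ 0 := fun h0 => by
    have := derivative_eq_zero.1 h0
    omega
  -- Over `ℂ`, simple roots amount to coprimality with the derivative; simplicity itself is used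
  -- again only to count points.
  have h : IsGenericSymbol P α :=
    ⟨hd, isCoprime_derivative_of_nodup_roots hP0 hroots,
      isCoprime_derivative_of_nodup_roots hP'0 hroots', hα₀, hα₁⟩
  refine ⟨h.isAffineBoutroux,
    irreducible_scaledSymbol h.natDegree_ne_zero h.coprime hα₀.ne' hα₁,
    isRationalCurve_scaledSymbol h.natDegree_ne_zero h.coprime hα₀.ne' hα₁,
    h.fibre_infty,
    ⟨P.leadingCoeff, leadingCoeff_ne_zero.2 hP0,
      hasSlopePolynomial_scaledSymbol rfl (by omega) hα₀.ne'⟩,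
    roots_slopes hα₀.ne', ?_, h.singularPoints_eq,
    symbolParam P α, h.isNormalisation, h.hasImaginaryPeriods,
    fun x hx hx' => h.existsUnique_preimage hx hx',
    h.ncard_fibre_infty hroots', h.meromorphicAt_formCoeff, h.formOrder_neg_iff,
    fun p => h.formOrder_eq_of_neg, h.ncard_poles_over_roots hroots, ?_, ?_,
    OnePoint.infty, rfl, h.isSmoothBranchAtInfty_infty, h.hasFormResidue_infty, ?_⟩
  · intro h0
    have h1 : (P.natDegree : ℂ) ≠ 0 := Nat.cast_ne_zero.2 h.natDegree_ne_zero
    exact div_ne_zero h1 h.alpha_ne_zero (by linear_combination h0)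
  · intro z hz
    exact ⟨z, h.symbolParam_coe_of_eval_eq_zero hz,
      fun p hp => (h.symbolParam_eq_coe_infty_iff hz).1 hp⟩
  · intro z hz p hp
    rw [(h.symbolParam_eq_coe_infty_iff hz).1 hp]
    exact h.hasFormResidue_of_root hz
  · intro p hp hp'
    obtain ⟨u, hu, rfl⟩ := (h.symbolParam_eq_infty_zero_iff.1 hp).resolve_left hp'
    exact ⟨h.isSmoothBranchAtInfty_of_derivative_root hu, h.hasFormResidue_of_derivative_root hu⟩
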